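/- Let $n\ge 2$ be an integer, $\alpha\in\,]0,1[$, and let $\Omega^o,\Omega^i\subset\mathbb{R}^n$ be bounded open connected sets of class $C^{1,\alpha}$ (near each boundary point, after a rotation, the set is the strict hypograph of a $C^{1,\alpha}$ function) such that $\mathbb{R}^n\setminus\overline{\Omega^o}$ and $\mathbb{R}^n\setminus\overline{\Omega^i}$ are connected and $\overline{\Omega^i}\subset\Omega^o$. Let $\nu_{\Omega^o},\nu_{\Omega^i}$ be the outward unit normals. Let $A=\begin{pmatrix}A_{11}&A_{12}\\A_{21}&A_{22}\end{pmatrix}$ be a function from $\partial\Omega^i$ to the real $2\times2$ matrices, put $\tilde A=\begin{pmatrix}A_{11}&A_{12}\\-A_{21}&-A_{22}\end{pmatrix}$, and assume: 1. $A_{jk}\in C^{0,\alpha}(\partial\Omega^i)$ for all $j,k\in\{1,2\}$; 2. $\xi\,\tilde A(x)\,\xi^{T}\ge 0$ for all $\xi=(\xi_1,\xi_2)\in\mathbb{R}^2$ and all $x\in\partial\Omega^i$; 3. if $c=(c_1,c_2)\in\mathbb{R}^2$ and $A(x)c^{T}=0$ for all $x\in\partial\Omega^i$, then $c=(0,0)$.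 Then a pair $(u^o,u^i)\in C^{1,\alpha}(\overline{\Omega^o}\setminus\Omega^i)\times C^{1,\alpha}(\overline{\Omega^i})$ satisfies $$\begin{cases}\Delta u^o=0 & \text{in }\Omega^o\setminus\overline{\Omega^i},\\ \Delta u^i=0&\text{in }\Omega^i,\\ \nu_{\Omega^o}(x)\cdot\nabla u^o(x)=0&\forall x\in\partial\Omega^o,\\ \nu_{\Omega^i}(x)\cdot\nabla u^o(x)-A_{11}(x)u^o(x)-A_{12}(x)u^i(x)=0&\forall x\in\partial\Omega^i,\\ \nu_{\Omega^i}(x)\cdot\nabla u^i(x)-A_{21}(x)u^o(x)-A_{22}(x)u^i(x)=0&\forall x\in\partial\Omega^i\end{cases}$$ if and only if $u^o=0$ on $\overline{\Omega^o}\setminus\Omega^i$ and $u^i=0$ on $\overline{\Omega^i}$. Here $C^{1,\alpha}(\overline D)$, for $D$ open and bounded, is the space of the continuous functions on $\overline D$ that are $C^1$ in $D$ and whose gradient extends from $D$ to an $\alpha$-Hölder continuous map on $\overline D$; $\nabla u$ on the boundary denotes this extension. The space $C^{1,\alpha}(\overline{\Omega^o}\setminus\Omega^i)$ is $C^{1,\alpha}(\overline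 D)$ with $D=\Omega^o\setminus\overline{\Omega^i}$. -/

import Mathlib

open Set Filter Topology
open scoped NNReal

namespace Transmission

/-- The Euclidean space of dimension `n`. -/
abbrev Euc (n : ℕ) : Type := EuclideanSpace ℝ (Fin n)

/-- The open set `Ω` is of class `C^{1,α}`: near each of its boundary points `p` it is the strict
hypograph, in the direction of a unit vector `e`, of a `C^{1,α}` function `γ` of the component of
the point orthogonal to `e`. Only the values of `γ` on the hyperplane orthogonal to `e` near the
projection of `p` matter; by a cut-off it is no restriction that `γ` is defined everywhere. -/
def IsC1HolderSet {n : ℕ} (α : ℝ≥0) (Ω : Set (Euc n)) : Prop :=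
  ∀ p ∈ frontier Ω, ∃ (e : Euc n) (γ : Euc n → ℝ), ‖e‖ = 1 ∧ ContDiff ℝ 1 γ ∧
    (∃ C : ℝ≥0, HolderWith C α (fderiv ℝ γ)) ∧
    ∀ᶠ x in 𝓝 p, x ∈ Ω ↔ inner ℝ e x < γ (x - inner ℝ e x • e)

/-- A bounded, open, connected set of class `C^{1,α}` with connected exterior. -/
structure IsAdmissibleDomain {n : ℕ} (α : ℝ≥0) (Ω : Set (Euc n)) : Prop where
  isOpen : IsOpen Ω
  isBounded : Bornology.IsBounded Ω
  isConnected : IsConnected Ω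
  isC1Holder : IsC1HolderSet α Ω
  isConnected_exterior : IsConnected (closure Ω)ᶜ

/-- The unit vector `ν` is the outward normal to `Ω` at `x`: for every `ε > 0`, near `x`, the points
of the cone `ν · (y - x) > ε |y - x|` are outside `Ω` and those of the opposite cone
`ν · (y - x) < - ε |y - x|` are in `Ω`, that is, `Ω` is tangent at `x` to a half-space with
outward unit normal `ν`. -/
def IsOuterUnitNormal {n : ℕ} (Ω : Set (Euc n)) (x ν : Euc n) : Prop :=
  ‖ν‖ = 1 ∧ ∀ ε : ℝ, 0 < ε → ∀ᶠ y in 𝓝 x,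
    (ε * ‖y - x‖ < inner ℝ ν (y - x) → y ∉ Ω) ∧
    (inner ℝ ν (y - x) < -(ε * ‖y - x‖) → y ∈ Ω)

open Classical in
/-- The outward unit normal `ν_Ω(x)` (it exists and is unique at each boundary point of a set of
class `C^{1,α}`, see `existsUnique_outerNormal`; the value `0` is used when there is none). -/
noncomputable def outerNormal {n : ℕ} (Ω : Set (Euc n)) (x : Euc n) : Euc n :=
  if h : ∃ ν, IsOuterUnitNormal Ω x ν then h.choose else 0

/-- The gradient of `u` on the closure of the open set `D`: the extension by continuity of the
gradient of `u` in `D`. -/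
noncomputable def closureGradient {n : ℕ} (D : Set (Euc n)) (u : Euc n → ℝ) : Euc n → Euc n :=
  extendFrom D (gradient u)

/-- Membership of (the restriction to `closure D` of) `u` in `C^{1,α}(closure D)`, for `D` open:
`u` is `C^1` in `D` and continuous on `closure D`, its gradient in `D` extends by continuity to
`closure D`, and the extension is Hölder continuous with exponent `α` on `closure D`. -/
structure IsC1Holder {n : ℕ} (α : ℝ≥0) (D : Set (Euc n)) (u : Euc n → ℝ) : Prop where
  contDiffOn : ContDiffOn ℝ 1 u D
  continuousOn : ContinuousOn u (closure D)
  gradient_extends : ∀ x ∈ closure D, ∃ g : Euc n, Tendsto (gradient u) (𝓝[D] x) (𝓝 g)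
  holder : ∃ C : ℝ≥0, HolderOnWith C α (closureGradient D u) (closure D)

/-- The matrix obtained from `A` by changing the sign of the second row. -/
def tildeMatrix (A : Matrix (Fin 2) (Fin 2) ℝ) : Matrix (Fin 2) (Fin 2) ℝ :=
  !![A 0 0, A 0 1; -A 1 0, -A 1 1]

/-- The standing conditions on the matrix function `A` on `∂Ωi`. -/
structure MatrixCondition {n : ℕ} (α : ℝ≥0) (Ωi : Set (Euc n))
    (A : Euc n → Matrix (Fin 2) (Fin 2) ℝ) : Prop where
  holder : ∀ j k, ∃ C : ℝ≥0, HolderOnWith C α (fun x => A x j k) (frontier Ωi)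
  nonneg : ∀ ξ : Fin 2 → ℝ, ∀ x ∈ frontier Ωi, 0 ≤ ξ ⬝ᵥ Matrix.mulVec (tildeMatrix (A x)) ξ
  nondegenerate : ∀ c : Fin 2 → ℝ, (∀ x ∈ frontier Ωi, Matrix.mulVec (A x) c = 0) → c = 0

/-- `(uo, ui)` solves the homogeneous linear transmission problem. -/
structure SolvesTransmission {n : ℕ} (Ωo Ωi : Set (Euc n))
    (A : Euc n → Matrix (Fin 2) (Fin 2) ℝ) (uo ui : Euc n → ℝ) : Prop where
  harmonic_outer : InnerProductSpace.HarmonicOnNhd uo (Ωo \ closure Ωi)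
  harmonic_inner : InnerProductSpace.HarmonicOnNhd ui Ωi
  neumann : ∀ x ∈ frontier Ωo,
    inner ℝ (outerNormal Ωo x) (closureGradient (Ωo \ closure Ωi) uo x) = 0
  coupling_outer : ∀ x ∈ frontier Ωi,
    inner ℝ (outerNormal Ωi x) (closureGradient (Ωo \ closure Ωi) uo x)
      - A x 0 0 * uo x - A x 0 1 * ui x = 0
  coupling_inner : ∀ x ∈ frontier Ωi,
    inner ℝ (outerNormal Ωi x) (closureGradient Ωi ui x)
      - A x 1 0 * uo x - A x 1 1 * ui x = 0

/-- At most one vector is an outward unit normal. -/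
theorem IsOuterUnitNormal.unique {n : ℕ} {Ω : Set (Euc n)} {x ν μ : Euc n}
    (hν : IsOuterUnitNormal Ω x ν) (hμ : IsOuterUnitNormal Ω x μ) : ν = μ := by
  by_contra hne
  have hlt : inner ℝ ν μ < 1 := by
    exact (inner_lt_one_iff_real_of_norm_eq_one hν.1 hμ.1).2 hne
  set c : ℝ := inner ℝ ν μ with hc
  set w : Euc n := ν - μ with hw
  have hνν : inner ℝ ν ν = (1 : ℝ) := by rw [real_inner_self_eq_norm_sq, hν.1]; norm_num
  have hμμ : inner ℝ μ μ = (1 : ℝ) := by rw [real_inner_self_eq_norm_sq, hμ.1]; norm_num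
  have h1 : inner ℝ ν w = 1 - c := by rw [hw, inner_sub_right, hνν]
  have h2 : inner ℝ μ w = -(1 - c) := by
    rw [hw, inner_sub_right, hμμ, real_inner_comm, ← hc]; ring
  have hwpos : 0 < ‖w‖ := norm_pos_iff.2 (sub_ne_zero.2 hne)
  set ε : ℝ := (1 - c) / (2 * ‖w‖) with hε
  have hεpos : 0 < ε := by have : 0 < 1 - c := by linarith
                           positivity
  have hεw : ε * ‖w‖ = (1 - c) / 2 := by rw [hε]; field_simp
  have ht : Tendsto (fun t : ℝ => x + t • w) (𝓝[>] 0) (𝓝 x) := by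
    have : Continuous (fun t : ℝ => x + t • w) := by fun_prop
    have h := this.tendsto 0
    simp only [zero_smul, add_zero] at h
    exact h.mono_left nhdsWithin_le_nhds
  have hev := (ht.eventually ((hν.2 ε hεpos).and (hμ.2 ε hεpos))).and self_mem_nhdsWithin
  obtain ⟨t, ⟨⟨ha, -⟩, ⟨-, hb⟩⟩, htpos⟩ := hev.exists
  have htpos : 0 < t := htpos
  simp only [add_sub_cancel_left, norm_smul, inner_smul_right, Real.norm_eq_abs,
    abs_of_pos htpos, h1, h2] at ha hb
  have e1 : ε * (t * ‖w‖) = t * ((1 - c) / 2) := by rw [← hεw]; ring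
  rw [e1] at ha hb
  have hpos : 0 < t * (1 - c) := mul_pos htpos (by linarith)
  exact ha (by linarith) (hb (by linarith))

/-- The outward unit normal is well defined on the boundary of a set of class `C^{1,α}`. -/
theorem existsUnique_outerNormal {n : ℕ} {α : ℝ≥0} {Ω : Set (Euc n)} (hΩ : IsOpen Ω)
    (h : IsC1HolderSet α Ω) {p : Euc n} (hp : p ∈ frontier Ω) :
    ∃! ν, IsOuterUnitNormal Ω p ν := by
  obtain ⟨e, γ, he, hγ, -, hU⟩ := h p hp
  set ρ : Euc n → ℝ := fun x => inner ℝ e x - γ (x - inner ℝ e x • e) with hρ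
  have hρd : DifferentiableAt ℝ ρ p := by
    have hd : Differentiable ℝ γ := hγ.differentiable one_ne_zero
    have : Differentiable ℝ ρ := by
      have h1 : Differentiable ℝ (fun x : Euc n => (inner ℝ e x : ℝ)) :=
        (innerSL ℝ e).differentiable
      exact h1.sub (hd.comp (differentiable_id.sub (h1.smul_const e)))
    exact this p
  set G : Euc n := gradient ρ p with hG
  have hgrad : HasGradientAt ρ G p := hρd.hasGradientAt
  have hee : inner ℝ e e = (1 : ℝ) := by rw [real_inner_self_eq_norm_sq, he]; norm_num
  have hline : ∀ t : ℝ, ρ (p + t • e) = ρ p + t := by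
    intro t
    have : p + t • e - (inner ℝ e (p + t • e) : ℝ) • e = p - (inner ℝ e p : ℝ) • e := by
      rw [inner_add_right, inner_smul_right, hee, add_smul, mul_one]; abel
    change (inner ℝ e (p + t • e) : ℝ) - γ (p + t • e - (inner ℝ e (p + t • e) : ℝ) • e)
      = inner ℝ e p - γ (p - (inner ℝ e p : ℝ) • e) + t
    rw [this, inner_add_right, inner_smul_right, hee]; ring
  have hGe : inner ℝ G e = (1 : ℝ) := by
    have h1 : HasDerivAt (fun t : ℝ => ρ (p + t • e)) (inner ℝ G e) 0 := by
      have h2 : HasDerivAt (fun t : ℝ => p + t • e) e 0 := by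
        simpa using ((hasDerivAt_id (0 : ℝ)).smul_const e).const_add p
      have h3 : HasFDerivAt ρ (InnerProductSpace.toDual ℝ (Euc n) G) (p + (0 : ℝ) • e) := by
        simpa using hgrad.hasFDerivAt
      exact h3.comp_hasDerivAt (0 : ℝ) h2
    have h2 : HasDerivAt (fun t : ℝ => ρ (p + t • e)) 1 0 := by
      simp only [hline]
      exact (hasDerivAt_id (0 : ℝ)).const_add (ρ p)
    exact h1.unique h2
  have hGne : G ≠ 0 := by
    intro h0; rw [h0, inner_zero_left] at hGe; exact zero_ne_one hGe
  have hGpos : 0 < ‖G‖ := norm_pos_iff.2 hGne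
  have hmem : ∀ᶠ x in 𝓝 p, x ∈ Ω ↔ ρ x < 0 := by
    filter_upwards [hU] with x hx
    rw [hx]; simp only [hρ, sub_neg]
  have hp0 : ρ p = 0 := by
    have hpΩ : p ∉ Ω := fun hh => by
      rw [frontier, hΩ.interior_eq] at hp; exact hp.2 hh
    have hge : 0 ≤ ρ p := not_lt.1 (fun hh => hpΩ (hmem.self_of_nhds.2 hh))
    have hfr : ∃ᶠ x in 𝓝 p, x ∈ Ω := mem_closure_iff_frequently.1 hp.1
    refine le_antisymm ?_ hge
    by_contra hgt
    have hpos : ∀ᶠ x in 𝓝 p, 0 < ρ x :=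
      hρd.continuousAt.eventually (lt_mem_nhds (not_le.1 hgt))
    obtain ⟨x, hx, h1, h2⟩ := (hfr.and_eventually (hmem.and hpos)).exists
    exact lt_asymm h2 (h1.1 hx)
  refine existsUnique_of_exists_of_unique ⟨‖G‖⁻¹ • G, ?_, ?_⟩ fun _ _ h1 h2 => h1.unique h2
  · rw [norm_smul, norm_inv, norm_norm, inv_mul_cancel₀ hGpos.ne']
  · intro ε hε
    have hlo := hgrad.hasFDerivAt.isLittleO.def (c := ε * ‖G‖ / 2) (by positivity)
    filter_upwards [hlo, hmem] with y hy hyΩ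
    simp only [hp0, sub_zero, InnerProductSpace.toDual_apply_apply, Real.norm_eq_abs] at hy
    have hy := abs_le.1 hy
    have hi : (inner ℝ G (y - p) : ℝ) = ‖G‖ * inner ℝ (‖G‖⁻¹ • G) (y - p) := by
      rw [real_inner_smul_left]; field_simp
    have hn : 0 ≤ ‖y - p‖ := norm_nonneg _
    constructor
    · intro hlt hy'
      have := hyΩ.1 hy'
      have h3 := mul_lt_mul_of_pos_left hlt hGpos
      have h4 : 0 ≤ ε * ‖G‖ * ‖y - p‖ := by positivity
      rw [← hi] at h3
      nlinarith [hy.1]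
    · intro hlt
      apply hyΩ.2
      have h3 := mul_lt_mul_of_pos_left hlt hGpos
      have h4 : 0 ≤ ε * ‖G‖ * ‖y - p‖ := by positivity
      rw [← hi] at h3
      nlinarith [hy.2]

/-- `outerNormal` is the outward unit normal at boundary points of a set of class `C^{1,α}`. -/
theorem outerNormal_spec {n : ℕ} {α : ℝ≥0} {Ω : Set (Euc n)} (hΩ : IsOpen Ω)
    (h : IsC1HolderSet α Ω) {p : Euc n} (hp : p ∈ frontier Ω) :
    IsOuterUnitNormal Ω p (outerNormal Ω p) := by
  have hex := (existsUnique_outerNormal hΩ h hp).exists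
  rw [outerNormal, dif_pos hex]
  exact hex.choose_spec

end Transmission

/-!
Only the direct implication needs an argument, and it is the energy argument: Green's identity turns
`∫ |∇uo|² + ∫ |∇ui|²` into minus the integral over `∂Ωi` of the quadratic form of `Ã` at `(uo, ui)`,
so both gradients vanish; then both functions are constant, and the nondegeneracy of `A` forces the
constants to be `0`.

No surface measure is used. Let `S = ∂Ωo ∪ ∂Ωi` and let `u` be `uo` between the boundaries, `ui` in
`Ωi` and `0` outside `Ωo`, so that `u` is harmonic off `S`. The point is that the distribution
`|∇u|² - div (u ∇u)`, where `∇u` is the pointwise gradient off `S`, is nonpositive. Off `S` it is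
`0` (`integral_greenDensity_eq_zero`). Near a point of `S` there is a `C^1` function `ρ` whose zeros
are the nearby points of `S` and that satisfies `ρ (x + s e) = ρ x + s`
(`IsC1HolderSet.exists_definingFunction`). Testing with a cutoff that removes the layer `|ρ| ≤ t`
leaves two integrals of `u ∇u · ∇ρ` over thin layers on the two sides of `S`; the translation by
`3 t e` carries one layer onto the other, so only the difference of the two flux densities matters,
and its limit on `S` is a nonnegative multiple of the quadratic form of `Ã`
(`setIntegral_greenDensity_nonpos_of_jump`). The layers have mass of order `t` because
`e · ∇ρ = 1`, so that the layer density is a derivative that can be integrated by parts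
(`exists_bound_integral_layer`). A partition of unity then yields `∫ |∇u|² ≤ 0`
(`gradient_eq_zero_of_locally_nonpos`).

The connectedness of `Ωo \ closure Ωi` is not assumed. That a locally constant function on it is
constant follows from the connectedness of `Ωo` and of the exterior of `Ωi` by the Poincaré lemma
(`exists_forall_eq_of_locally_constant_diff`).
-/

namespace Transmission

open MeasureTheory InnerProductSpace
open scoped Gradient Manifold

/-! ### Green's first identity against test functions -/

section Energy

theorem integrableOn_of_bounded_of_eq_zero {X : Type*} [TopologicalSpace X] [T2Space X]
    [MeasurableSpace X] [BorelSpace X] {μ : Measure X} [IsFiniteMeasureOnCompacts μ] {U K : Set X}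
    {f : X → ℝ} {C : ℝ} (hU : IsOpen U)
    (hK : IsCompact K) (hf : ContinuousOn f U) (hC : ∀ x ∈ U, |f x| ≤ C)
    (h0 : ∀ x ∈ U, x ∉ K → f x = 0) : IntegrableOn f U μ := by
  have h1 : IntegrableOn f (U ∩ K) μ := by
    refine IntegrableOn.of_bound ((measure_mono inter_subset_right).trans_lt hK.measure_lt_top)
      ((hf.mono inter_subset_left).aestronglyMeasurable (hU.measurableSet.inter hK.measurableSet))
      C ?_
    filter_upwards [ae_restrict_mem (hU.measurableSet.inter hK.measurableSet)] with x hx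
    exact hC x hx.1
  exact h1.of_forall_sdiff_eq_zero hU.measurableSet fun x hx =>
    h0 x hx.1 fun hxK => hx.2 ⟨hx.1, hxK⟩

variable {E : Type*} [NormedAddCommGroup E] [InnerProductSpace ℝ E]

theorem fderiv_eq_zero_of_notMem_tsupport {f : E → ℝ} {x : E} (hx : x ∉ tsupport f) :
    fderiv ℝ f x = 0 := by
  rw [(notMem_tsupport_iff_eventuallyEq.1 hx).fderiv_eq]
  simp

theorem abs_fderiv_apply_le {f : E → ℝ} {M C : ℝ} {x v : E} (hM : ‖fderiv ℝ f x‖ ≤ M)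
    (hv : ‖v‖ ≤ C) : |fderiv ℝ f x v| ≤ M * C :=
  ((fderiv ℝ f x).le_opNorm v).trans
    (mul_le_mul hM hv (norm_nonneg _) ((norm_nonneg _).trans hM))

theorem exists_bound_fderiv_of_hasCompactSupport {f : E → ℝ} (hf : ContDiff ℝ 1 f)
    (hc : HasCompactSupport f) : ∃ M, ∀ x, |f x| ≤ M ∧ ‖fderiv ℝ f x‖ ≤ M := by
  obtain ⟨M1, h1⟩ := hf.continuous.bounded_above_of_compact_support hc
  obtain ⟨M2, h2⟩ := (hf.continuous_fderiv one_ne_zero).bounded_above_of_compact_support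
    (hc.fderiv (𝕜 := ℝ))
  exact ⟨max M1 M2, fun x => ⟨(h1 x).trans (le_max_left _ _), (h2 x).trans (le_max_right _ _)⟩⟩

variable [FiniteDimensional ℝ E]

/-- The divergence of `f • (u • ∇u)` at a point where `u` is harmonic; its integral is the weak form
of Green's first identity for `u` tested against `f`. -/
noncomputable def greenDensity (u f : E → ℝ) (x : E) : ℝ :=
  f x * ‖∇ u x‖ ^ 2 + u x * fderiv ℝ f x (∇ u x)

theorem greenDensity_eq_zero_of_notMem_tsupport {u f : E → ℝ} {x : E} (hx : x ∉ tsupport f) :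
    greenDensity u f x = 0 := by
  simp [greenDensity, fderiv_eq_zero_of_notMem_tsupport hx, image_eq_zero_of_notMem_tsupport hx]

theorem sum_fderiv_apply_orthonormalBasis {ι : Type*} [Fintype ι] (b : OrthonormalBasis ι ℝ E)
    (l : E →L[ℝ] ℝ) (u : E → ℝ) (x : E) :
    ∑ i, l (b i) * fderiv ℝ u x (b i) = l (∇ u x) := by
  conv_rhs => rw [← b.sum_repr' (∇ u x)]
  simp only [map_sum, map_smul, smul_eq_mul]
  refine Finset.sum_congr rfl fun i _ => ?_
  rw [real_inner_comm, inner_gradient_left, mul_comm]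

theorem norm_gradient_sq_eq_sum {ι : Type*} [Fintype ι] (b : OrthonormalBasis ι ℝ E)
    (u : E → ℝ) (x : E) :
    ∑ i, fderiv ℝ u x (b i) * fderiv ℝ u x (b i) = ‖∇ u x‖ ^ 2 := by
  rw [sum_fderiv_apply_orthonormalBasis, ← inner_gradient_left, real_inner_self_eq_norm_sq]

theorem continuousOn_gradient_of_harmonicOnNhd {u : E → ℝ} {U : Set E} (hu : HarmonicOnNhd u U) :
    ContinuousOn (∇ u) U := fun x hx => by
  have h : ContinuousAt (fderiv ℝ u) x :=
    ((hu x hx).1.fderiv_right (m := 1) (by norm_num)).continuousAt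
  exact ((toDual ℝ E).symm.continuous.continuousAt.comp h).continuousWithinAt

theorem continuousOn_greenDensity {u f : E → ℝ} {U : Set E} (hf : ContDiff ℝ 1 f)
    (hu : HarmonicOnNhd u U) : ContinuousOn (greenDensity u f) U := by
  have hg := continuousOn_gradient_of_harmonicOnNhd hu
  exact (hf.continuous.continuousOn.mul (hg.norm.pow 2)).add
    (hu.continuousOn.mul ((hf.continuous_fderiv one_ne_zero).continuousOn.clm_apply hg))

variable [MeasurableSpace E] [BorelSpace E] {μ : Measure E} [μ.IsAddHaarMeasure]

theorem integral_fderiv_apply_eq_zero {f : E → ℝ} (hf : ContDiff ℝ 1 f) (hc : HasCompactSupport f)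
    (v : E) : ∫ x, fderiv ℝ f x v ∂μ = 0 := by
  have hd : Continuous fun x => fderiv ℝ f x v :=
    (hf.continuous_fderiv one_ne_zero).clm_apply continuous_const
  have h := integral_mul_fderiv_eq_neg_fderiv_mul_of_integrable (μ := μ) (𝕜 := ℝ) (f := fun _ => 1)
    (g := f) (v := v) (by simp)
    (by simpa using hd.integrable_of_hasCompactSupport (hc.fderiv_apply (𝕜 := ℝ) v))
    (by simpa using hf.continuous.integrable_of_hasCompactSupport hc)
    (fun x _ => by fun_prop) (fun x _ => hf.differentiable one_ne_zero x)
  simpa using h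

/-- Green's first identity in weak form. -/
theorem integral_greenDensity_eq_zero {u f : E → ℝ} (hf : ContDiff ℝ 1 f)
    (hc : HasCompactSupport f) (hu : HarmonicOnNhd u (tsupport f)) :
    ∫ x, greenDensity u f x ∂μ = 0 := by
  set b := stdOrthonormalBasis ℝ E with hb
  set F : Fin (Module.finrank ℝ E) → E → ℝ := fun i x => f x * (u x * fderiv ℝ u x (b i)) with hF
  have hFs : ∀ i, Function.support (F i) ⊆ Function.support f := fun i =>
    Function.support_mul_subset_left _ _
  have hu2 : ∀ x ∈ tsupport f, ContDiffAt ℝ 1 (fderiv ℝ u) x := fun x hx =>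
    (hu x hx).1.fderiv_right (by norm_num)
  have hFd : ∀ i, ContDiff ℝ 1 (F i) := by
    intro i
    rw [contDiff_iff_contDiffAt]
    intro x
    by_cases hx : x ∈ tsupport f
    · have h1 : ContDiffAt ℝ 1 u x := (hu x hx).1.of_le (by norm_num)
      exact hf.contDiffAt.mul (h1.mul ((hu2 x hx).clm_apply contDiffAt_const))
    · have : F i =ᶠ[𝓝 x] fun _ => 0 := by
        filter_upwards [notMem_tsupport_iff_eventuallyEq.1 hx] with y hy
        simp [hF, hy]
      exact contDiffAt_const.congr_of_eventuallyEq this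
  have hFc : ∀ i, HasCompactSupport (F i) := fun i => hc.mono (hFs i)
  have hint : ∀ i, Integrable (fun x => fderiv ℝ (F i) x (b i)) μ := fun i =>
    (((hFd i).continuous_fderiv one_ne_zero).clm_apply
      continuous_const).integrable_of_hasCompactSupport ((hFc i).fderiv_apply (𝕜 := ℝ) (b i))
  have hsum : ∀ x, greenDensity u f x = ∑ i, fderiv ℝ (F i) x (b i) := by
    intro x
    by_cases hx : x ∈ tsupport f
    · have hfd : DifferentiableAt ℝ f x := hf.differentiable one_ne_zero x
      have hud : DifferentiableAt ℝ u x := (hu x hx).1.differentiableAt (by norm_num)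
      have hud2 : DifferentiableAt ℝ (fderiv ℝ u) x := (hu2 x hx).differentiableAt one_ne_zero
      have h1 : ∀ i, fderiv ℝ (F i) x (b i) = u x * (fderiv ℝ f x (b i) * fderiv ℝ u x (b i))
          + f x * (fderiv ℝ u x (b i) * fderiv ℝ u x (b i))
          + f x * u x * iteratedFDeriv ℝ 2 u x ![b i, b i] := by
        intro i
        have h2 : HasFDerivAt (fun y => fderiv ℝ u y (b i))
            ((fderiv ℝ (fderiv ℝ u) x).flip (b i)) x := by
          simpa using hud2.hasFDerivAt.clm_apply (hasFDerivAt_const (b i) x)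
        have h3 := (hfd.hasFDerivAt.mul (hud.hasFDerivAt.mul h2)).fderiv
        change fderiv ℝ (F i) x = _ at h3
        rw [h3, iteratedFDeriv_two_apply]
        simp
        ring
      have hlap : ∑ i, iteratedFDeriv ℝ 2 u x ![b i, b i] = 0 := by
        have := (hu x hx).2.self_of_nhds
        rwa [laplacian_eq_iteratedFDeriv_orthonormalBasis u b] at this
      simp only [h1, Finset.sum_add_distrib, ← Finset.mul_sum, hlap, norm_gradient_sq_eq_sum,
        sum_fderiv_apply_orthonormalBasis, greenDensity]
      ring
    · rw [greenDensity_eq_zero_of_notMem_tsupport hx, Finset.sum_eq_zero]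
      intro i _
      rw [fderiv_eq_zero_of_notMem_tsupport fun h => hx (closure_mono (hFs i) h)]
      simp
  simp only [hsum]
  rw [integral_finsetSum _ fun i _ => hint i]
  exact Finset.sum_eq_zero fun i _ => integral_fderiv_apply_eq_zero (hFd i) (hFc i) _

theorem integrableOn_greenDensity {u f : E → ℝ} {U : Set E} {C : ℝ} (hU : IsOpen U)
    (hf : ContDiff ℝ 1 f) (hc : HasCompactSupport f) (hu : HarmonicOnNhd u U)
    (hC : ∀ x ∈ U, |u x| ≤ C ∧ ‖∇ u x‖ ≤ C) : IntegrableOn (greenDensity u f) U μ := by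
  obtain ⟨M, hM⟩ := exists_bound_fderiv_of_hasCompactSupport hf hc
  refine integrableOn_of_bounded_of_eq_zero (C := M * C ^ 2 + C * (M * C)) hU hc
    (continuousOn_greenDensity hf hu) (fun x hx => ?_)
    fun x _ hx => greenDensity_eq_zero_of_notMem_tsupport hx
  have hM0 : 0 ≤ M := (abs_nonneg _).trans (hM x).1
  have hC0 : 0 ≤ C := (abs_nonneg _).trans (hC x hx).1
  refine (abs_add_le _ _).trans (add_le_add ?_ ?_)
  · rw [abs_mul, abs_of_nonneg (sq_nonneg ‖∇ u x‖)]
    exact mul_le_mul (hM x).1 (pow_le_pow_left₀ (norm_nonneg _) (hC x hx).2 2) (by positivity) hM0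
  · rw [abs_mul]
    exact mul_le_mul (hC x hx).1 (abs_fderiv_apply_le (hM x).2 (hC x hx).2) (abs_nonneg _) hC0

end Energy

/-! ### Cutoffs of thin layers around a hypersurface -/

section Step

/-- A smooth nondecreasing function on the line, equal to `0` on `]-∞, 1]` and to `1` on
`[2, ∞[`. -/
noncomputable def step (s : ℝ) : ℝ := Real.smoothTransition (s - 1)

theorem contDiff_step : ContDiff ℝ 1 step :=
  (Real.smoothTransition.contDiff (n := 1)).comp (contDiff_id.sub contDiff_const)

theorem step_eq_zero {s : ℝ} (hs : s ≤ 1) : step s = 0 :=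
  Real.smoothTransition.zero_of_nonpos (by linarith)

theorem step_eq_one {s : ℝ} (hs : 2 ≤ s) : step s = 1 :=
  Real.smoothTransition.one_of_one_le (by linarith)

theorem step_nonneg (s : ℝ) : 0 ≤ step s := Real.smoothTransition.nonneg _

theorem step_le_one (s : ℝ) : step s ≤ 1 := Real.smoothTransition.le_one _

theorem continuous_deriv_step : Continuous (deriv step) :=
  contDiff_step.continuous_deriv le_rfl

theorem deriv_step_nonneg (s : ℝ) : 0 ≤ deriv step s :=
  Monotone.deriv_nonneg fun _ _ h => Real.smoothTransition.monotone (sub_le_sub_right h 1)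

theorem deriv_step_eq_zero {s : ℝ} (hs : s ∉ Icc 1 2) : deriv step s = 0 := by
  by_cases h : s < 1
  · have : step =ᶠ[𝓝 s] fun _ => 0 := by
      filter_upwards [Iio_mem_nhds h] with r hr using step_eq_zero (le_of_lt hr)
    rw [this.deriv_eq, deriv_const]
  · have h2 : 2 < s := by
      by_contra h2
      exact hs ⟨not_lt.1 h, not_lt.1 h2⟩
    have : step =ᶠ[𝓝 s] fun _ => 1 := by
      filter_upwards [Ioi_mem_nhds h2] with r hr using step_eq_one (le_of_lt hr)
    rw [this.deriv_eq, deriv_const]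

end Step

section Cutoff

variable {X : Type*} {S : Set X} {φ ρ : X → ℝ}

/-- The function equal to `1` where `2 t ≤ |ρ|` and to `0` where `|ρ| ≤ t`, whose two transition
layers `-2 t ≤ ρ ≤ -t` and `t ≤ ρ ≤ 2 t` have profiles that are complementary under the translation
of `ρ` by `3 t`. -/
noncomputable def layerCutoff (ρ : X → ℝ) (t : ℝ) (x : X) : ℝ :=
  step (ρ x / t) + 1 - step (ρ x / t + 3)

theorem layerCutoff_eq_zero {t : ℝ} {x : X} (h : ρ x / t ∈ Icc (-1) 1) :
    layerCutoff ρ t x = 0 := by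
  rw [layerCutoff, step_eq_zero h.2, step_eq_one (by linarith [h.1])]
  ring

theorem layerCutoff_eq_one {t : ℝ} {x : X} (h : ρ x / t ≤ -2 ∨ 2 ≤ ρ x / t) :
    layerCutoff ρ t x = 1 := by
  rcases h with h | h
  · rw [layerCutoff, step_eq_zero (by linarith), step_eq_zero (by linarith)]; ring
  · rw [layerCutoff, step_eq_one h, step_eq_one (by linarith)]; ring

theorem abs_layerCutoff_le (t : ℝ) (x : X) : |layerCutoff ρ t x| ≤ 2 := by
  have h1 := step_nonneg (ρ x / t)
  have h2 := step_nonneg (ρ x / t + 3)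
  have h3 := step_le_one (ρ x / t)
  have h4 := step_le_one (ρ x / t + 3)
  rw [layerCutoff, abs_le]
  constructor <;> linarith

variable [TopologicalSpace X]

theorem tsupport_mul_layerCutoff_subset (hρ : Continuous ρ) {t : ℝ} (ht : 0 < t)
    (hφS : ∀ x ∈ tsupport φ, x ∈ S → ρ x = 0) :
    tsupport (fun x => φ x * layerCutoff ρ t x) ⊆ Sᶜ := by
  have h1 : tsupport (fun x => φ x * layerCutoff ρ t x) ⊆ tsupport φ ∩ {x | t ≤ |ρ x|} := by
    refine closure_minimal (fun x hx => ⟨subset_closure (left_ne_zero_of_mul hx), ?_⟩)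
      ((isClosed_tsupport φ).inter (isClosed_le continuous_const hρ.abs))
    by_contra hlt
    refine right_ne_zero_of_mul hx (layerCutoff_eq_zero ?_)
    rw [mem_ofPred_eq, not_le, abs_lt] at hlt
    rw [mem_Icc, le_div_iff₀ ht, div_le_iff₀ ht]
    constructor <;> linarith
  intro x hx hxS
  have h2 := h1 hx
  have h3 : t ≤ |ρ x| := h2.2
  rw [hφS x h2.1 hxS, abs_zero] at h3
  linarith

end Cutoff

section Layer

variable {E : Type*} [NormedAddCommGroup E] [InnerProductSpace ℝ E] {ρ : E → ℝ} {e : E}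

theorem hasFDerivAt_step_comp (hρ : ContDiff ℝ 1 ρ) (t c : ℝ) (x : E) :
    HasFDerivAt (fun y => step (ρ y / t + c)) ((deriv step (ρ x / t + c) * t⁻¹) • fderiv ℝ ρ x)
      x := by
  have h1 : HasFDerivAt (fun y => ρ y / t + c) (t⁻¹ • fderiv ℝ ρ x) x := by
    simpa [div_eq_mul_inv, mul_comm] using
      ((hρ.differentiable one_ne_zero x).hasFDerivAt.const_mul t⁻¹).add_const c
  have h2 : HasDerivAt step (deriv step (ρ x / t + c)) (ρ x / t + c) :=
    (contDiff_step.differentiable one_ne_zero _).hasDerivAt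
  have h3 := h2.comp_hasFDerivAt x h1
  rw [smul_smul] at h3
  exact h3

theorem contDiff_step_comp (hρ : ContDiff ℝ 1 ρ) (t c : ℝ) :
    ContDiff ℝ 1 fun y => step (ρ y / t + c) :=
  contDiff_step.comp ((hρ.div_const t).add contDiff_const)

theorem contDiff_layerCutoff (hρ : ContDiff ℝ 1 ρ) (t : ℝ) : ContDiff ℝ 1 (layerCutoff ρ t) := by
  have h := contDiff_step_comp hρ t 0
  simp only [add_zero] at h
  exact (h.add contDiff_const).sub (contDiff_step_comp hρ t 3)

theorem fderiv_apply_eq_one_of_forall_add_smul (hρ : ContDiff ℝ 1 ρ)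
    (hρe : ∀ x (s : ℝ), ρ (x + s • e) = ρ x + s) (x : E) : fderiv ℝ ρ x e = 1 := by
  have h2 : HasDerivAt (fun s : ℝ => x + s • e) e 0 := by
    simpa using ((hasDerivAt_id (0 : ℝ)).smul_const e).const_add x
  have h3 : HasFDerivAt ρ (fderiv ℝ ρ x) (x + (0 : ℝ) • e) := by
    simpa using (hρ.differentiable one_ne_zero x).hasFDerivAt
  have h4 := h3.comp_hasDerivAt (0 : ℝ) h2
  have h5 : HasDerivAt (fun s : ℝ => ρ (x + s • e)) 1 0 := by
    simp only [hρe]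
    exact (hasDerivAt_id (0 : ℝ)).const_add (ρ x)
  exact h4.unique h5

/-- The values of `J` on the two sides of the hypersurface `ρ = 0`, at points that are translates of
each other, are compared uniformly on thin layers. -/
theorem eventually_forall_layer_sub_ge [ProperSpace E] (hρ : Continuous ρ)
    (hρe : ∀ x (s : ℝ), ρ (x + s • e) = ρ x + s) {J : E → ℝ} {R ε : ℝ} (hε : 0 ≤ ε)
    (hR : ∀ x, x ∉ Metric.closedBall (0 : E) R → J x = 0)
    (hJ : ∀ q, ρ q = 0 → ∀ᶠ z in 𝓝 q ×ˢ 𝓝 q, 0 < ρ z.1 → ρ z.2 < 0 → -ε ≤ J z.1 - J z.2) :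
    ∀ᶠ t : ℝ in 𝓝[>] 0, ∀ x, ρ x / t ∈ Icc 1 2 → -ε ≤ J x - J (x - (3 * t) • e) := by
  have hK : ∀ᶠ t : ℝ in 𝓝 0, ∀ x ∈ Metric.closedBall (0 : E) (R + 1), 0 < t → ρ x / t ∈ Icc 1 2 →
      -ε ≤ J x - J (x - (3 * t) • e) := by
    refine (isCompact_closedBall (0 : E) (R + 1)).eventually_forall_of_forall_eventually
      fun q _ => ?_
    by_cases hq : ρ q = 0
    · have h1 : Tendsto (fun z : ℝ × E => (z.2, z.2 - (3 * z.1) • e)) (𝓝 (0, q)) (𝓝 q ×ˢ 𝓝 q) := by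
        have hc : Continuous (fun z : ℝ × E => (z.2, z.2 - (3 * z.1) • e)) := by fun_prop
        have := hc.tendsto (0, q)
        simpa [nhds_prod_eq] using this
      filter_upwards [h1.eventually (hJ q hq)] with z hz ht hx
      rw [mem_Icc, le_div_iff₀ ht, div_le_iff₀ ht] at hx
      refine hz (by linarith) ?_
      have := hρe z.2 (-(3 * z.1))
      rw [neg_smul, ← sub_eq_add_neg] at this
      simp only [this]
      linarith
    · have h1 : ∀ᶠ z : ℝ × E in 𝓝 (0, q), 2 * |z.1| < |ρ z.2| := by
        have hc : Continuous (fun z : ℝ × E => |ρ z.2| - 2 * |z.1|) := by fun_prop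
        have h2 : (0 : ℝ) < |ρ q| - 2 * |(0 : ℝ)| := by simpa using hq
        filter_upwards [hc.continuousAt.eventually (lt_mem_nhds h2)] with z hz
        linarith
      filter_upwards [h1] with z hz ht hx
      rw [mem_Icc, le_div_iff₀ ht, div_le_iff₀ ht] at hx
      rw [abs_of_pos ht, abs_of_nonneg (by linarith)] at hz
      linarith
  have hsmall : ∀ᶠ t : ℝ in 𝓝 0, ‖(3 * t) • e‖ < 1 := by
    have hc : Continuous (fun t : ℝ => ‖(3 * t) • e‖) := by fun_prop
    exact hc.continuousAt.eventually (gt_mem_nhds (by simp))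
  filter_upwards [nhdsWithin_le_nhds hK, nhdsWithin_le_nhds hsmall, self_mem_nhdsWithin]
    with t h1 h2 ht x hx
  by_cases hxK : x ∈ Metric.closedBall (0 : E) (R + 1)
  · exact h1 x hxK ht hx
  · rw [mem_closedBall_zero_iff, not_le] at hxK
    have h3 := norm_sub_norm_le x ((3 * t) • e)
    rw [hR x, hR (x - (3 * t) • e)]
    · linarith
    · rw [mem_closedBall_zero_iff]; linarith
    · rw [mem_closedBall_zero_iff]; linarith

variable [FiniteDimensional ℝ E] [MeasurableSpace E] [BorelSpace E] {μ : Measure E}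
  [μ.IsAddHaarMeasure]

/-- The layers `t ≤ ρ ≤ 2 t` carry a mass of order `t` near any compact set. -/
theorem exists_bound_integral_layer (hρ : ContDiff ℝ 1 ρ)
    (hρe : ∀ x (s : ℝ), ρ (x + s • e) = ρ x + s) {ψ : E → ℝ} (hψ : ContDiff ℝ 1 ψ)
    (hc : HasCompactSupport ψ) :
    ∃ C, ∀ t : ℝ, Integrable (fun x => deriv step (ρ x / t) * t⁻¹ * ψ x) μ ∧
      ∫ x, deriv step (ρ x / t) * t⁻¹ * ψ x ∂μ ≤ C := by
  have hd : Continuous fun x => fderiv ℝ ψ x e :=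
    (hψ.continuous_fderiv one_ne_zero).clm_apply continuous_const
  have hdc : HasCompactSupport fun x => fderiv ℝ ψ x e := hc.fderiv_apply (𝕜 := ℝ) e
  refine ⟨∫ x, |fderiv ℝ ψ x e| ∂μ, fun t => ?_⟩
  have hs : Continuous fun x => step (ρ x / t) := by
    simpa using (contDiff_step_comp hρ t 0).continuous
  have hi1 : Integrable (fun x => deriv step (ρ x / t) * t⁻¹ * ψ x) μ := by
    refine Continuous.integrable_of_hasCompactSupport ?_ hc.mul_left
    have := continuous_deriv_step
    have := hρ.continuous
    have := hψ.continuous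
    fun_prop
  have hi2 : Integrable (fun x => step (ρ x / t) * fderiv ℝ ψ x e) μ :=
    (hs.mul hd).integrable_of_hasCompactSupport hdc.mul_left
  refine ⟨hi1, ?_⟩
  have h0 := integral_fderiv_apply_eq_zero (μ := μ) (f := fun x => step (ρ x / t) * ψ x)
    (by simpa using (contDiff_step_comp hρ t 0).mul hψ) hc.mul_left e
  have h1 : ∀ x, fderiv ℝ (fun x => step (ρ x / t) * ψ x) x e
      = deriv step (ρ x / t) * t⁻¹ * ψ x + step (ρ x / t) * fderiv ℝ ψ x e := by
    intro x
    have h2 := hasFDerivAt_step_comp hρ t 0 x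
    simp only [add_zero] at h2
    rw [(h2.fun_mul (hψ.differentiable one_ne_zero x).hasFDerivAt).fderiv]
    simp [fderiv_apply_eq_one_of_forall_add_smul hρ hρe x]
    ring
  simp only [h1] at h0
  rw [integral_add hi1 hi2] at h0
  rw [eq_neg_of_add_eq_zero_left h0, ← integral_neg]
  refine integral_mono hi2.neg (hd.abs.integrable_of_hasCompactSupport hdc.abs) fun x => ?_
  simp only
  calc -(step (ρ x / t) * fderiv ℝ ψ x e) ≤ |step (ρ x / t) * fderiv ℝ ψ x e| := neg_le_abs _
    _ = step (ρ x / t) * |fderiv ℝ ψ x e| := by rw [abs_mul, abs_of_nonneg (step_nonneg _)]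
    _ ≤ 1 * |fderiv ℝ ψ x e| := by gcongr; exact step_le_one _
    _ = _ := one_mul _

end Layer

/-! ### The jump condition across a hypersurface -/

section Jump

variable {E : Type*} [NormedAddCommGroup E] [InnerProductSpace ℝ E] [FiniteDimensional ℝ E]
  {S : Set E} {u φ ρ : E → ℝ} {e : E} {C : ℝ}

/-- The density `φ u ∇u · ∇ρ` of the flux of `φ u ∇u` across the level sets of `ρ`, extended by `0`
on `S`. -/
noncomputable def fluxDensity (S : Set E) (u ρ φ : E → ℝ) : E → ℝ :=
  Sᶜ.indicator fun x => φ x * (u x * fderiv ℝ ρ x (∇ u x))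

theorem greenDensity_mul_layerCutoff (hφ : ContDiff ℝ 1 φ) (hρ : ContDiff ℝ 1 ρ) (t : ℝ) (x : E) :
    greenDensity u (fun x => φ x * layerCutoff ρ t x) x
      = layerCutoff ρ t x * greenDensity u φ x
        + (deriv step (ρ x / t) * t⁻¹ - deriv step (ρ x / t + 3) * t⁻¹)
          * (φ x * (u x * fderiv ℝ ρ x (∇ u x))) := by
  have h := hasFDerivAt_step_comp hρ t 0 x
  simp only [add_zero] at h
  have h1 : HasFDerivAt (layerCutoff ρ t) _ x :=
    (h.add_const 1).sub (hasFDerivAt_step_comp hρ t 3 x)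
  rw [greenDensity, ((hφ.differentiable one_ne_zero x).hasFDerivAt.fun_mul h1).fderiv, greenDensity]
  simp
  ring

variable [MeasurableSpace E] [BorelSpace E] {μ : Measure E} [μ.IsAddHaarMeasure]

theorem integrable_mul_fluxDensity (hS : IsClosed S) (hu : HarmonicOnNhd u Sᶜ)
    (hC : ∀ x ∈ Sᶜ, |u x| ≤ C ∧ ‖∇ u x‖ ≤ C) (hρ : ContDiff ℝ 1 ρ) (hφ : Continuous φ)
    (hc : HasCompactSupport φ) {m : E → ℝ} (hm : Continuous m) :
    Integrable (fun x => m x * fluxDensity S u ρ φ x) μ := by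
  have hg := continuousOn_gradient_of_harmonicOnNhd hu
  have hρ' := hρ.continuous_fderiv one_ne_zero
  have hck : Continuous fun x => m x * φ x * ‖fderiv ℝ ρ x‖ := (hm.mul hφ).mul hρ'.norm
  obtain ⟨M, hM⟩ := hck.bounded_above_of_compact_support hc.mul_left.mul_right
  have h1 : (fun x => m x * fluxDensity S u ρ φ x)
      = Sᶜ.indicator fun x => m x * φ x * (u x * fderiv ℝ ρ x (∇ u x)) := by
    funext x
    by_cases hx : x ∈ Sᶜ <;> simp [fluxDensity, hx, mul_assoc]
  rw [h1, integrable_indicator_iff hS.measurableSet.compl]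
  refine integrableOn_of_bounded_of_eq_zero (C := M * (C * C)) hS.isOpen_compl hc ?_ ?_ ?_
  · exact (hm.mul hφ).continuousOn.mul (hu.continuousOn.mul (hρ'.continuousOn.clm_apply hg))
  · intro x hx
    have hC0 : 0 ≤ C := (abs_nonneg _).trans (hC x hx).1
    calc |m x * φ x * (u x * fderiv ℝ ρ x (∇ u x))|
        = |m x * φ x| * (|u x| * |fderiv ℝ ρ x (∇ u x)|) := by rw [abs_mul, abs_mul (u x)]
      _ ≤ |m x * φ x| * (C * (‖fderiv ℝ ρ x‖ * C)) := by
          gcongr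
          · exact (hC x hx).1
          · exact abs_fderiv_apply_le le_rfl (hC x hx).2
      _ = ‖m x * φ x * ‖fderiv ℝ ρ x‖‖ * (C * C) := by
          rw [norm_mul, norm_norm, Real.norm_eq_abs]; ring
      _ ≤ M * (C * C) := by gcongr; exact hM x
  · intro x _ hx
    simp [image_eq_zero_of_notMem_tsupport hx]

/-- Green's identity tested against `φ` times a cutoff of the layers around `ρ = 0`. The inner layer
is translated onto the outer one, so that the flux densities on both sides are subtracted. -/
theorem setIntegral_layerCutoff_mul_greenDensity (hS : IsClosed S) (hu : HarmonicOnNhd u Sᶜ)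
    (hC : ∀ x ∈ Sᶜ, |u x| ≤ C ∧ ‖∇ u x‖ ≤ C) (hρ : ContDiff ℝ 1 ρ)
    (hρe : ∀ x (s : ℝ), ρ (x + s • e) = ρ x + s) (hφ : ContDiff ℝ 1 φ)
    (hc : HasCompactSupport φ) (hφS : ∀ x ∈ tsupport φ, x ∈ S → ρ x = 0) {t : ℝ} (ht : 0 < t) :
    Integrable (fun x => deriv step (ρ x / t) * t⁻¹ *
      (fluxDensity S u ρ φ x - fluxDensity S u ρ φ (x - (3 * t) • e))) μ ∧
    ∫ x in Sᶜ, layerCutoff ρ t x * greenDensity u φ x ∂μ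
      = -∫ x, deriv step (ρ x / t) * t⁻¹ *
        (fluxDensity S u ρ φ x - fluxDensity S u ρ φ (x - (3 * t) • e)) ∂μ := by
  set J := fluxDensity S u ρ φ with hJ
  have hk := continuous_deriv_step
  have hρc := hρ.continuous
  have hi1 : Integrable (fun x => deriv step (ρ x / t) * t⁻¹ * J x) μ :=
    integrable_mul_fluxDensity hS hu hC hρ hφ.continuous hc (by fun_prop)
  have hi2 : Integrable (fun x => deriv step (ρ x / t + 3) * t⁻¹ * J x) μ :=
    integrable_mul_fluxDensity hS hu hC hρ hφ.continuous hc (by fun_prop)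
  have hshift : ∀ x, ρ (x - (3 * t) • e) / t + 3 = ρ x / t := by
    intro x
    have := hρe x (-(3 * t))
    rw [neg_smul, ← sub_eq_add_neg] at this
    rw [this]
    field_simp
    ring
  have hi3 := hi2.comp_sub_right ((3 * t) • e)
  have h3 := integral_sub_right_eq_self (μ := μ) (fun x => deriv step (ρ x / t + 3) * t⁻¹ * J x)
    ((3 * t) • e)
  simp only [hshift] at hi3 h3
  have hsup := tsupport_mul_layerCutoff_subset hρc ht hφS
  have hφη : ContDiff ℝ 1 fun x => φ x * layerCutoff ρ t x := hφ.mul (contDiff_layerCutoff hρ t)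
  have hG := integral_greenDensity_eq_zero (μ := μ) hφη hc.mul_right (hu.mono hsup)
  rw [← setIntegral_eq_integral_of_forall_compl_eq_zero (s := Sᶜ) fun x hx =>
    greenDensity_eq_zero_of_notMem_tsupport fun h => hx (hsup h)] at hG
  have hcong : ∀ x ∈ Sᶜ, greenDensity u (fun x => φ x * layerCutoff ρ t x) x
      = layerCutoff ρ t x * greenDensity u φ x
        + (deriv step (ρ x / t) * t⁻¹ * J x - deriv step (ρ x / t + 3) * t⁻¹ * J x) := by
    intro x hx
    rw [greenDensity_mul_layerCutoff hφ hρ, hJ, fluxDensity, indicator_of_mem hx]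
    ring
  have hi4 : IntegrableOn (fun x => layerCutoff ρ t x * greenDensity u φ x) Sᶜ μ := by
    refine Integrable.bdd_mul (c := 2) (integrableOn_greenDensity hS.isOpen_compl hφ hc hu hC)
      (contDiff_layerCutoff hρ t).continuous.aestronglyMeasurable ?_
    exact ae_of_all _ fun x => abs_layerCutoff_le t x
  have hfull : ∫ x in Sᶜ, (deriv step (ρ x / t) * t⁻¹ * J x
      - deriv step (ρ x / t + 3) * t⁻¹ * J x) ∂μ
      = ∫ x, (deriv step (ρ x / t) * t⁻¹ * J x - deriv step (ρ x / t + 3) * t⁻¹ * J x) ∂μ := by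
    refine setIntegral_eq_integral_of_forall_compl_eq_zero fun x hx => ?_
    rw [hJ, fluxDensity, indicator_of_notMem hx]
    ring
  have hi5 : IntegrableOn (fun x => deriv step (ρ x / t) * t⁻¹ * J x
      - deriv step (ρ x / t + 3) * t⁻¹ * J x) Sᶜ μ := (hi1.sub hi2).integrableOn
  rw [setIntegral_congr_fun hS.measurableSet.compl hcong,
    integral_add hi4 hi5, hfull, integral_sub hi1 hi2, ← h3] at hG
  simp only [mul_sub]
  refine ⟨hi1.sub hi3, ?_⟩
  rw [integral_sub hi1 hi3]
  linarith

theorem tendsto_setIntegral_layerCutoff_mul_greenDensity (hS : IsClosed S)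
    (hu : HarmonicOnNhd u Sᶜ) (hC : ∀ x ∈ Sᶜ, |u x| ≤ C ∧ ‖∇ u x‖ ≤ C) (hρ : ContDiff ℝ 1 ρ)
    (hφ : ContDiff ℝ 1 φ) (hc : HasCompactSupport φ)
    (hφS : ∀ x ∈ tsupport φ, x ∉ S → ρ x ≠ 0) :
    Tendsto (fun t => ∫ x in Sᶜ, layerCutoff ρ t x * greenDensity u φ x ∂μ) (𝓝[>] 0)
      (𝓝 (∫ x in Sᶜ, greenDensity u φ x ∂μ)) := by
  have hG : IntegrableOn (greenDensity u φ) Sᶜ μ :=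
    integrableOn_greenDensity hS.isOpen_compl hφ hc hu hC
  refine tendsto_integral_filter_of_dominated_convergence (fun x => 2 * |greenDensity u φ x|)
    (Eventually.of_forall fun t => ?_) (Eventually.of_forall fun t => ?_) (hG.abs.const_mul 2) ?_
  · exact (contDiff_layerCutoff hρ t).continuous.aestronglyMeasurable.mul hG.aestronglyMeasurable
  · refine ae_of_all _ fun x => ?_
    rw [Real.norm_eq_abs, abs_mul]
    exact mul_le_mul_of_nonneg_right (abs_layerCutoff_le t x) (abs_nonneg _)
  · filter_upwards [ae_restrict_mem hS.measurableSet.compl] with x hx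
    refine tendsto_const_nhds.congr' ?_
    by_cases hxφ : x ∈ tsupport φ
    · have h0 : 0 < |ρ x| / 2 := by
        have := abs_pos.2 (hφS x hxφ hx)
        linarith
      filter_upwards [Ioo_mem_nhdsGT h0] with t ht
      rw [layerCutoff_eq_one, one_mul]
      rw [le_div_iff₀ ht.1, div_le_iff₀ ht.1]
      have h2 := ht.2
      rcases abs_cases (ρ x) with h | h
      · right; linarith
      · left; linarith
    · exact Eventually.of_forall fun t => by
        simp [greenDensity_eq_zero_of_notMem_tsupport hxφ]

/-- If the flux of `u ∇u` through the hypersurface `ρ = 0` does not decrease in the direction of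
`∇ρ`, then `|∇u|² - div (u ∇u)` is a nonpositive distribution near the hypersurface. -/
theorem setIntegral_greenDensity_nonpos_of_jump (hS : IsClosed S) (hu : HarmonicOnNhd u Sᶜ)
    (hC : ∀ x ∈ Sᶜ, |u x| ≤ C ∧ ‖∇ u x‖ ≤ C) (hρ : ContDiff ℝ 1 ρ)
    (hρe : ∀ x (s : ℝ), ρ (x + s • e) = ρ x + s) {U : Set E} (hSU : ∀ x ∈ U, x ∈ S ↔ ρ x = 0)
    (hjump : ∀ q ∈ U, ρ q = 0 → ∃ a b : ℝ, b ≤ a ∧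
      Tendsto (fun x => u x * fderiv ℝ ρ x (∇ u x)) (𝓝[{x | 0 < ρ x}] q) (𝓝 a) ∧
      Tendsto (fun x => u x * fderiv ℝ ρ x (∇ u x)) (𝓝[{x | ρ x < 0}] q) (𝓝 b))
    (hφ : ContDiff ℝ 1 φ) (hc : HasCompactSupport φ) (hφU : tsupport φ ⊆ U)
    (hφ0 : ∀ x, 0 ≤ φ x) :
    ∫ x in Sᶜ, greenDensity u φ x ∂μ ≤ 0 := by
  set J := fluxDensity S u ρ φ with hJ
  have hJ0 : ∀ x ∉ tsupport φ, J x = 0 := fun x hx => by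
    simp [hJ, fluxDensity, image_eq_zero_of_notMem_tsupport hx]
  have hJS : ∀ x, ρ x ≠ 0 → J x = φ x * (u x * fderiv ℝ ρ x (∇ u x)) := by
    intro x hx
    by_cases hxφ : x ∈ tsupport φ
    · have : x ∈ Sᶜ := fun h => hx ((hSU x (hφU hxφ)).1 h)
      rw [hJ, fluxDensity, indicator_of_mem this]
    · rw [hJ0 x hxφ, image_eq_zero_of_notMem_tsupport hxφ, zero_mul]
  -- The one-sided limits of `J` at the points of the hypersurface give the local comparison.
  have hlocal : ∀ ε : ℝ, 0 < ε → ∀ q, ρ q = 0 →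
      ∀ᶠ z in 𝓝 q ×ˢ 𝓝 q, 0 < ρ z.1 → ρ z.2 < 0 → -ε ≤ J z.1 - J z.2 := by
    intro ε hε q hq
    by_cases hqφ : q ∈ tsupport φ
    · obtain ⟨a, b, hab, ha, hb⟩ := hjump q (hφU hqφ) hq
      have hφq : ∀ s : Set E, Tendsto φ (𝓝[s] q) (𝓝 (φ q)) := fun s =>
        hφ.continuous.continuousAt.continuousWithinAt
      have h1 : Tendsto J (𝓝[{x | 0 < ρ x}] q) (𝓝 (φ q * a)) := by
        refine ((hφq _).mul ha).congr' ?_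
        filter_upwards [self_mem_nhdsWithin] with x hx using (hJS x (ne_of_gt hx)).symm
      have h2 : Tendsto J (𝓝[{x | ρ x < 0}] q) (𝓝 (φ q * b)) := by
        refine ((hφq _).mul hb).congr' ?_
        filter_upwards [self_mem_nhdsWithin] with x hx using (hJS x (ne_of_lt hx)).symm
      have h3 := h1.eventually (lt_mem_nhds (sub_lt_self (φ q * a) (half_pos hε)))
      have h4 := h2.eventually (gt_mem_nhds (lt_add_of_pos_right (φ q * b) (half_pos hε)))
      filter_upwards [(eventually_nhdsWithin_iff.1 h3).prod_mk (eventually_nhdsWithin_iff.1 h4)]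
        with z hz hz1 hz2
      have h5 := mul_le_mul_of_nonneg_left hab (hφ0 q)
      have h6 := hz.1 hz1
      have h7 := hz.2 hz2
      linarith
    · have h1 : ∀ᶠ x in 𝓝 q, x ∉ tsupport φ :=
        (isClosed_tsupport φ).isOpen_compl.mem_nhds hqφ
      filter_upwards [h1.prod_mk h1] with z hz _ _
      rw [hJ0 _ hz.1, hJ0 _ hz.2]
      linarith
  obtain ⟨R, hR⟩ := hc.isCompact.isBounded.subset_closedBall 0
  -- A cutoff equal to `1` on a ball that contains the support of `J` and of its small translates.
  set ψ : ContDiffBump (0 : E) := ⟨|R| + 1, |R| + 2, by positivity, by linarith⟩ with hψ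
  obtain ⟨B, hB⟩ := exists_bound_integral_layer (μ := μ) hρ hρe (ψ.contDiff (n := 1))
    ψ.hasCompactSupport
  have hB0 : 0 ≤ B := by simpa using (hB 0).2
  have hsmall : ∀ᶠ t : ℝ in 𝓝[>] 0, ‖(3 * t) • e‖ < 1 := by
    have hcont : Continuous (fun t : ℝ => ‖(3 * t) • e‖) := by fun_prop
    exact nhdsWithin_le_nhds (hcont.continuousAt.eventually (gt_mem_nhds (by simp)))
  have hkey : ∀ ε : ℝ, 0 < ε → ∫ x in Sᶜ, greenDensity u φ x ∂μ ≤ ε * B := by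
    intro ε hε
    refine le_of_tendsto (tendsto_setIntegral_layerCutoff_mul_greenDensity hS hu hC hρ hφ hc
      fun x hx hxS h => hxS ((hSU x (hφU hx)).2 h)) ?_
    filter_upwards [self_mem_nhdsWithin, hsmall, eventually_forall_layer_sub_ge hρ.continuous hρe
      hε.le (fun x hx => hJ0 x fun h => hx (hR h)) (hlocal ε hε)] with t ht hte hlay
    obtain ⟨hint, heq⟩ := setIntegral_layerCutoff_mul_greenDensity (μ := μ) hS hu hC hρ hρe hφ hc
      (fun x hx hxS => (hSU x (hφU hx)).1 hxS) ht
    rw [heq, ← integral_neg]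
    refine (integral_mono hint.neg ((hB t).1.const_mul ε) fun x => ?_).trans ?_
    · have hd : 0 ≤ deriv step (ρ x / t) * t⁻¹ :=
        mul_nonneg (deriv_step_nonneg _) (inv_nonneg.2 (le_of_lt ht))
      simp only [Pi.neg_apply]
      by_cases hx : ρ x / t ∈ Icc 1 2
      · have h1 : -(J x - J (x - (3 * t) • e)) ≤ ε * ψ x := by
          by_cases hxR : x ∈ Metric.closedBall (0 : E) (|R| + 1)
          · rw [ψ.one_of_mem_closedBall hxR]
            linarith [hlay x hx]
          · rw [mem_closedBall_zero_iff, not_le] at hxR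
            have h3 := norm_sub_norm_le x ((3 * t) • e)
            have h4 := le_abs_self R
            rw [hJ0 x, hJ0 (x - (3 * t) • e)]
            · simpa using mul_nonneg hε.le ψ.nonneg
            · intro h
              have := hR h
              rw [mem_closedBall_zero_iff] at this
              linarith
            · intro h
              have := hR h
              rw [mem_closedBall_zero_iff] at this
              linarith
        linarith [mul_le_mul_of_nonneg_left h1 hd]
      · rw [deriv_step_eq_zero hx]
        simp
    · rw [integral_const_mul]
      exact mul_le_mul_of_nonneg_left (hB t).2 hε.le
  refine le_of_forall_pos_le_add fun δ hδ => ?_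
  refine (hkey (δ / (B + 1)) (by positivity)).trans ?_
  rw [zero_add, div_mul_eq_mul_div, div_le_iff₀ (by linarith)]
  nlinarith

end Jump

/-! ### Vanishing of the gradient from local nonpositivity -/

section Global

variable {E : Type*} [NormedAddCommGroup E] [InnerProductSpace ℝ E] [FiniteDimensional ℝ E]

section

variable [MeasurableSpace E] [BorelSpace E] {μ : Measure E} [μ.IsAddHaarMeasure]

/-- If the distribution `|∇u|² - div (u ∇u)` is nonpositive near each point, and `u` vanishes
outside a compact set, then by a partition of unity `∇u = 0` off `S`. -/
theorem gradient_eq_zero_of_locally_nonpos {S K : Set E} {u : E → ℝ} {C : ℝ} (hS : IsClosed S)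
    (hu : HarmonicOnNhd u Sᶜ) (hC : ∀ x ∈ Sᶜ, |u x| ≤ C ∧ ‖∇ u x‖ ≤ C) (hK : IsCompact K)
    (hu0 : ∀ x ∉ K, u x = 0)
    (hloc : ∀ p, ∃ U, IsOpen U ∧ p ∈ U ∧ ∀ φ : E → ℝ, ContDiff ℝ 1 φ → HasCompactSupport φ →
      tsupport φ ⊆ U → (∀ x, 0 ≤ φ x) → ∫ x in Sᶜ, greenDensity u φ x ∂μ ≤ 0) :
    ∀ x ∈ Sᶜ, ∇ u x = 0 := by
  obtain ⟨R, hR⟩ := hK.isBounded.subset_closedBall 0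
  set χ : ContDiffBump (0 : E) := ⟨|R| + 1, |R| + 2, by positivity, by linarith⟩ with hχ
  have hgrad0 : ∀ x ∉ Metric.ball (0 : E) (|R| + 1), ∇ u x = 0 := by
    intro x hx
    have hxK : x ∉ K := fun h => hx <| by
      have h1 := hR h
      rw [mem_closedBall_zero_iff] at h1
      rw [mem_ball_zero_iff]
      linarith [le_abs_self R]
    have : u =ᶠ[𝓝 x] fun _ => 0 := by
      filter_upwards [hK.isClosed.isOpen_compl.mem_nhds hxK] with y hy using hu0 y hy
    rw [this.gradient_eq, gradient_fun_const]
  choose U hUo hpU hU using hloc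
  obtain ⟨f, hf⟩ := SmoothPartitionOfUnity.exists_isSubordinate 𝓘(ℝ, E) (s := univ) isClosed_univ U
    hUo fun x _ => mem_iUnion.2 ⟨x, hpU x⟩
  have hfd : ∀ i, ContDiff ℝ 1 (f i) := fun i =>
    (f i).contMDiff.contDiff.of_le (by exact_mod_cast le_top)
  have hfin : {i | (Function.support (f i) ∩ tsupport χ).Nonempty}.Finite :=
    f.locallyFinite.finite_nonempty_inter_compact χ.hasCompactSupport
  set I := hfin.toFinset with hI
  have hsum1 : ∀ x ∈ tsupport χ, ∑ i ∈ I, f i x = 1 := by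
    intro x hx
    rw [← f.sum_eq_one (mem_univ x), finsum_eq_sum_of_support_subset]
    intro i hi
    rw [hI, Finite.coe_toFinset]
    exact ⟨x, hi, hx⟩
  have hprod : ∀ i, ContDiff ℝ 1 fun x => f i x * χ x := fun i => (hfd i).mul χ.contDiff
  have hχsum : (fun x => ∑ i ∈ I, f i x * χ x) = χ := by
    funext x
    rw [← Finset.sum_mul]
    by_cases hx : x ∈ tsupport χ
    · rw [hsum1 x hx, one_mul]
    · rw [image_eq_zero_of_notMem_tsupport hx, mul_zero]
  have hGsum : ∀ x, greenDensity u χ x = ∑ i ∈ I, greenDensity u (fun x => f i x * χ x) x := by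
    intro x
    have h1 : ∑ i ∈ I, fderiv ℝ (fun x => f i x * χ x) x = fderiv ℝ χ x := by
      rw [← fderiv_fun_sum fun i _ => (hprod i).differentiable one_ne_zero x, hχsum]
    have h2 : ∑ i ∈ I, f i x * χ x = χ x := congrFun hχsum x
    simp only [greenDensity]
    rw [Finset.sum_add_distrib, ← Finset.sum_mul, ← Finset.mul_sum, h2, ← h1, sum_apply]
  have hle : ∫ x in Sᶜ, greenDensity u χ x ∂μ ≤ 0 := by
    simp only [hGsum]
    rw [integral_finsetSum _ fun i _ => integrableOn_greenDensity hS.isOpen_compl (hprod i)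
      χ.hasCompactSupport.mul_left hu hC]
    refine Finset.sum_nonpos fun i _ => hU i _ (hprod i) χ.hasCompactSupport.mul_left
      ((closure_mono (Function.support_mul_subset_left _ _)).trans (hf i)) fun x =>
      mul_nonneg (f.nonneg i x) χ.nonneg
  have hGχ : ∀ x, greenDensity u χ x = ‖∇ u x‖ ^ 2 := by
    intro x
    by_cases hx : x ∈ Metric.ball (0 : E) (|R| + 1)
    · have h1 : (χ : E → ℝ) =ᶠ[𝓝 x] fun _ => 1 := by
        filter_upwards [Metric.isOpen_ball.mem_nhds hx] with y hy
        exact χ.one_of_mem_closedBall (Metric.ball_subset_closedBall hy)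
      rw [greenDensity, h1.fderiv_eq, h1.self_of_nhds]
      simp
    · simp [greenDensity, hgrad0 x hx]
  have hint : IntegrableOn (fun x => ‖∇ u x‖ ^ 2) Sᶜ μ := by
    simpa only [← hGχ] using
      integrableOn_greenDensity hS.isOpen_compl χ.contDiff χ.hasCompactSupport hu hC
  simp only [hGχ] at hle
  have hzero := (setIntegral_eq_zero_iff_of_nonneg_ae
    (ae_of_all _ fun x => sq_nonneg ‖∇ u x‖) hint).1
    (le_antisymm hle (integral_nonneg fun x => sq_nonneg _))
  have hg := continuousOn_gradient_of_harmonicOnNhd hu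
  have hEq : EqOn (fun x => ‖∇ u x‖ ^ 2) 0 Sᶜ :=
    Measure.eqOn_open_of_ae_eq hzero hS.isOpen_compl (hg.norm.pow 2) continuousOn_const
  intro x hx
  simpa using hEq hx

end

/-! ### Locally constant functions on a difference of sets -/

/-- Let `K` be a closed subset of a connected open set `Ω`. If the complement of `K` is connected,
then a locally constant function `v` on `Ω \ K` is constant. With a cutoff `χ` that is `1` near `K`
and `0` near the complement of `Ω`, the form `v dχ` extends to a closed form on the whole space. A
primitive `W` differs by constants from `v χ` on the complement of `K` and from `-v (1 - χ)` on
`Ω`. -/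
theorem exists_forall_eq_of_locally_constant_diff {Ω K : Set E} (hΩ : IsOpen Ω)
    (hΩc : IsPreconnected Ω) (hK : IsClosed K) (hKΩ : K ⊆ Ω) (hKc : IsPreconnected Kᶜ) {v : E → ℝ}
    (hv : ∀ x ∈ Ω \ K, ∀ᶠ y in 𝓝 x, v y = v x) : ∃ c, ∀ x ∈ Ω \ K, v x = c := by
  obtain ⟨χ, h0, h1, -⟩ := exists_contMDiffMap_zero_one_nhds_of_isClosed 𝓘(ℝ, E) (n := 2)
    hΩ.isClosed_compl hK (disjoint_compl_left_iff_subset.2 hKΩ)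
  rw [eventually_nhdsSet_iff_forall] at h0 h1
  have hχ : ContDiff ℝ 2 χ := χ.contMDiff.contDiff
  have hD : IsOpen (Ω \ K) := hΩ.sdiff hK
  set w : E → ℝ := (Ω \ K).indicator v with hw
  have hwD : ∀ x ∈ Ω \ K, w =ᶠ[𝓝 x] fun _ => v x := by
    intro x hx
    filter_upwards [hv x hx, hD.mem_nhds hx] with y hy hyD
    rw [hw, indicator_of_mem hyD, hy]
  have hwx : ∀ x ∈ Ω \ K, w x = v x := fun x hx => (hwD x hx).self_of_nhds
  have hχD : Differentiable ℝ χ := hχ.differentiable two_ne_zero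
  have hdχ : Differentiable ℝ (fderiv ℝ χ) :=
    (hχ.fderiv_right (m := 1) (by norm_num)).differentiable one_ne_zero
  set η : E → (E →L[ℝ] ℝ) := fun x => w x • fderiv ℝ χ x with hη
  have hηloc : ∀ x, ∃ c : ℝ, η =ᶠ[𝓝 x] fun y => c • fderiv ℝ χ y := by
    intro x
    by_cases hx : x ∈ Ω \ K
    · exact ⟨v x, (hwD x hx).mono fun y hy => by simp only [hη, hy]⟩
    · refine ⟨0, ?_⟩
      obtain ⟨c, hc⟩ : ∃ c : ℝ, (χ : E → ℝ) =ᶠ[𝓝 x] fun _ => c := by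
        by_cases hxΩ : x ∈ Ω
        · exact ⟨1, h1 x (by_contra fun h => hx ⟨hxΩ, h⟩)⟩
        · exact ⟨0, h0 x hxΩ⟩
      filter_upwards [hc.fderiv (𝕜 := ℝ)] with y hy
      simp [hη, hy]
  obtain ⟨W, hW⟩ := convex_univ.exists_forall_hasFDerivAt_of_fderiv_symmetric isOpen_univ (ω := η)
    (fun x _ => by
      obtain ⟨c, hc⟩ := hηloc x
      exact (((hdχ x).const_smul c).congr_of_eventuallyEq hc).differentiableWithinAt)
    (fun x _ a b => by
      obtain ⟨c, hc⟩ := hηloc x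
      have := ContDiffAt.isSymmSndFDerivAt (𝕜 := ℝ) (hχ.contDiffAt (x := x)) (by simp) a b
      rw [hc.fderiv_eq, fderiv_fun_const_smul (hdχ x)]
      simp [this])
  have hWd : ∀ x, HasFDerivAt W (η x) x := fun x => hW x (mem_univ x)
  have hext : ∀ x ∈ Kᶜ, HasFDerivAt (fun y => W y - w y * χ y) (0 : E →L[ℝ] ℝ) x := by
    intro x hx
    have : HasFDerivAt (fun y => w y * χ y) (η x) x := by
      by_cases hxΩ : x ∈ Ω
      · have h2 := ((hχD x).hasFDerivAt.const_mul (v x)).congr_of_eventuallyEq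
          (f₁ := fun y => w y * χ y) ((hwD x ⟨hxΩ, hx⟩).mono fun y hy => by simp only [hy])
        simpa only [hη, hwx x ⟨hxΩ, hx⟩] using h2
      · have h2 : HasFDerivAt (fun y => w y * χ y) (0 : E →L[ℝ] ℝ) x :=
          (hasFDerivAt_const (0 : ℝ) x).congr_of_eventuallyEq
            ((h0 x hxΩ).mono fun y hy => by simp only [hy, mul_zero])
        have h3 : w x = 0 := indicator_of_notMem (fun h => hxΩ h.1) v
        simpa [hη, h3] using h2
    simpa using (hWd x).fun_sub this
  have hint : ∀ x ∈ Ω, HasFDerivAt (fun y => W y + w y * (1 - χ y)) (0 : E →L[ℝ] ℝ) x := by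
    intro x hx
    have : HasFDerivAt (fun y => w y * (1 - χ y)) (-η x) x := by
      by_cases hxK : x ∈ K
      · have h2 : HasFDerivAt (fun y => w y * (1 - χ y)) (0 : E →L[ℝ] ℝ) x :=
          (hasFDerivAt_const (0 : ℝ) x).congr_of_eventuallyEq
            ((h1 x hxK).mono fun y hy => by simp only [hy, sub_self, mul_zero])
        have h3 : w x = 0 := indicator_of_notMem (fun h => h.2 hxK) v
        simpa [hη, h3] using h2
      · have h2 := (((hχD x).hasFDerivAt.const_sub 1).const_mul (v x)).congr_of_eventuallyEq
          (f₁ := fun y => w y * (1 - χ y)) ((hwD x ⟨hx, hxK⟩).mono fun y hy => by simp only [hy])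
        simpa only [hη, hwx x ⟨hx, hxK⟩, smul_neg] using h2
    simpa using (hWd x).fun_add this
  rcases (Ω \ K).eq_empty_or_nonempty with he | ⟨x₀, hx₀⟩
  · exact ⟨0, fun x hx => by simp [he] at hx⟩
  refine ⟨v x₀, fun x hx => ?_⟩
  have e1 := hK.isOpen_compl.is_const_of_fderiv_eq_zero hKc
    (fun y hy => (hext y hy).differentiableAt.differentiableWithinAt)
    (fun y hy => (hext y hy).fderiv) hx.2 hx₀.2
  have e2 := hΩ.is_const_of_fderiv_eq_zero hΩc
    (fun y hy => (hint y hy).differentiableAt.differentiableWithinAt)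
    (fun y hy => (hint y hy).fderiv) hx.1 hx₀.1
  simp only [hwx x hx, hwx x₀ hx₀] at e1 e2
  linarith

end Global

/-! ### Defining functions, normals and boundary regularity -/

section Geometry

variable {n : ℕ} {α : ℝ≥0} {Ω U : Set (Euc n)} {ρ : Euc n → ℝ} {e : Euc n}

/-- Near a boundary point, a set of class `C^{1,α}` is the sublevel set of a `C^1` function that
grows with unit speed in some direction. -/
theorem IsC1HolderSet.exists_definingFunction (h : IsC1HolderSet α Ω) {p : Euc n}
    (hp : p ∈ frontier Ω) :
    ∃ (e : Euc n) (ρ : Euc n → ℝ), ContDiff ℝ 1 ρ ∧ (∀ x (s : ℝ), ρ (x + s • e) = ρ x + s) ∧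
      ∀ᶠ x in 𝓝 p, x ∈ Ω ↔ ρ x < 0 := by
  obtain ⟨e, γ, he, hγ, -, hU⟩ := h p hp
  have hee : inner ℝ e e = (1 : ℝ) := by rw [real_inner_self_eq_norm_sq, he]; norm_num
  refine ⟨e, fun x => inner ℝ e x - γ (x - inner ℝ e x • e), ?_, fun x s => ?_, ?_⟩
  · have h1 : ContDiff ℝ 1 fun x : Euc n => (inner ℝ e x : ℝ) := contDiff_const.inner ℝ contDiff_id
    exact h1.sub (hγ.comp (contDiff_id.sub (h1.smul contDiff_const)))
  · have : x + s • e - (inner ℝ e (x + s • e) : ℝ) • e = x - (inner ℝ e x : ℝ) • e := by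
      rw [inner_add_right, inner_smul_right, hee, add_smul, mul_one]; abel
    simp only [this]
    rw [inner_add_right, inner_smul_right, hee]
    ring
  · filter_upwards [hU] with x hx
    rw [hx, sub_neg]

theorem tendsto_add_smul_nhdsGT (q v : Euc n) :
    Tendsto (fun s : ℝ => q + s • v) (𝓝[>] 0) (𝓝 q) := by
  have hc : Continuous fun s : ℝ => q + s • v := by fun_prop
  have h := hc.tendsto 0
  simp only [zero_smul, add_zero] at h
  exact h.mono_left nhdsWithin_le_nhds

theorem notMem_closure_iff_of_definingFunction (hU : IsOpen U) (hρ : Continuous ρ)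
    (hρe : ∀ x (s : ℝ), ρ (x + s • e) = ρ x + s) (hΩU : ∀ x ∈ U, x ∈ Ω ↔ ρ x < 0) {x : Euc n}
    (hx : x ∈ U) : x ∉ closure Ω ↔ 0 < ρ x := by
  refine ⟨fun h => ?_, fun h hcl => ?_⟩
  · by_contra hle
    refine h (mem_closure_of_tendsto (tendsto_add_smul_nhdsGT x (-e)) ?_)
    filter_upwards [(tendsto_add_smul_nhdsGT x (-e)).eventually (hU.mem_nhds hx),
      self_mem_nhdsWithin] with s hs hs0
    have hs0 : 0 < s := hs0
    rw [hΩU _ hs, smul_neg, ← neg_smul, hρe]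
    linarith
  · obtain ⟨y, ⟨hyU, hy⟩, hyΩ⟩ := mem_closure_iff.1 hcl _
      (hU.inter (isOpen_lt continuous_const hρ)) ⟨hx, h⟩
    exact lt_asymm hy ((hΩU y hyU).1 hyΩ)

theorem mem_frontier_iff_of_definingFunction (hΩ : IsOpen Ω) (hU : IsOpen U) (hρ : Continuous ρ)
    (hρe : ∀ x (s : ℝ), ρ (x + s • e) = ρ x + s) (hΩU : ∀ x ∈ U, x ∈ Ω ↔ ρ x < 0) {x : Euc n}
    (hx : x ∈ U) : x ∈ frontier Ω ↔ ρ x = 0 := by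
  rw [hΩ.frontier_eq, Set.mem_sdiff, hΩU x hx, ← not_not (a := x ∈ closure Ω),
    notMem_closure_iff_of_definingFunction hU hρ hρe hΩU hx, not_lt, not_lt]
  exact le_antisymm_iff.symm

/-- A defining function that is negative on the side of `Ω` has a differential proportional, with a
nonnegative factor, to the scalar product with the outward unit normal. -/
theorem exists_fderiv_eq_mul_inner_outerNormal (hΩ : IsOpen Ω) (h : IsC1HolderSet α Ω)
    (hU : IsOpen U) (hρ : ContDiff ℝ 1 ρ) (hΩU : ∀ x ∈ U, x ∈ Ω ↔ ρ x < 0) {q : Euc n}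
    (hq : q ∈ U) (hqΩ : q ∈ frontier Ω) (hq0 : ρ q = 0) :
    ∃ c : ℝ, 0 ≤ c ∧ ∀ v, fderiv ℝ ρ q v = c * inner ℝ (outerNormal Ω q) v := by
  set ν := outerNormal Ω q with hν
  obtain ⟨hν1, hνc⟩ : IsOuterUnitNormal Ω q ν := outerNormal_spec hΩ h hqΩ
  have hνν : inner ℝ ν ν = (1 : ℝ) := by rw [real_inner_self_eq_norm_sq, hν1]; norm_num
  -- Vectors pointing strictly inwards are descent directions of `ρ`.
  have hdesc : ∀ v, inner ℝ ν v < 0 → fderiv ℝ ρ q v ≤ 0 := by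
    intro v hv
    have h2 : HasDerivAt (fun s : ℝ => q + s • v) v 0 := by
      simpa using ((hasDerivAt_id (0 : ℝ)).smul_const v).const_add q
    have h3 : HasFDerivAt ρ (fderiv ℝ ρ q) (q + (0 : ℝ) • v) := by
      simpa using (hρ.differentiable one_ne_zero q).hasFDerivAt
    have h4 := (h3.comp_hasDerivAt (0 : ℝ) h2).tendsto_slope_zero_right
    refine le_of_tendsto h4 ?_
    have hv0 : 0 < ‖v‖ := norm_pos_iff.2 fun h0 => by simp [h0] at hv
    have hε : 0 < -inner ℝ ν v / (2 * ‖v‖) := div_pos (by linarith) (by linarith)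
    filter_upwards [(tendsto_add_smul_nhdsGT q v).eventually (hνc _ hε),
      (tendsto_add_smul_nhdsGT q v).eventually (hU.mem_nhds hq), self_mem_nhdsWithin]
      with s hs hsU hs0
    have hs0 : 0 < s := hs0
    have h5 : -inner ℝ ν v / (2 * ‖v‖) * (s * ‖v‖) = s * (-inner ℝ ν v / 2) := by field_simp
    have h6 := hs.2
    rw [add_sub_cancel_left, norm_smul, Real.norm_eq_abs, abs_of_pos hs0, h5, inner_smul_right]
      at h6
    have h7 := (hΩU _ hsU).1 (h6 (by nlinarith))
    simp only [Function.comp_apply, zero_add, zero_smul, add_zero, hq0, sub_zero, smul_eq_mul]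
    exact mul_nonpos_of_nonneg_of_nonpos (inv_nonneg.2 hs0.le) h7.le
  set G := ∇ ρ q with hG
  have hGv : ∀ v, fderiv ℝ ρ q v = inner ℝ G v := fun v => (inner_gradient_left).symm
  set c : ℝ := inner ℝ G ν with hc
  have hc0 : 0 ≤ c := by
    have := hdesc (-ν) (by rw [inner_neg_right, hνν]; norm_num)
    rw [hGv, inner_neg_right] at this
    linarith
  have hGG : inner ℝ G G - c * c ≤ 0 := by
    refine le_of_forall_pos_le_add fun δ hδ => ?_
    have hδ' : 0 < δ / (c + 1) := by positivity
    have := hdesc (G - c • ν - (δ / (c + 1)) • ν) (by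
      rw [inner_sub_right, inner_sub_right, inner_smul_right, inner_smul_right, hνν,
        real_inner_comm, ← hc]
      linarith)
    rw [hGv, inner_sub_right, inner_sub_right, inner_smul_right, inner_smul_right, ← hc] at this
    have h8 : δ / (c + 1) * c ≤ δ := by
      rw [div_mul_eq_mul_div, div_le_iff₀ (by linarith)]
      nlinarith
    linarith
  have hGc : G - c • ν = 0 := by
    rw [← norm_eq_zero, ← sq_eq_zero_iff]
    refine le_antisymm ?_ (sq_nonneg _)
    rw [← real_inner_self_eq_norm_sq, inner_sub_left, inner_sub_right, inner_sub_right,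
      inner_smul_left, inner_smul_left, inner_smul_right, inner_smul_right, hνν,
      real_inner_comm G ν, ← hc]
    simp only [conj_trivial]
    linarith
  refine ⟨c, hc0, fun v => ?_⟩
  rw [hGv, sub_eq_zero.1 hGc, real_inner_smul_left]

/-- The boundary of a set of class `C^{1,α}` consists of limits of exterior points. -/
theorem IsC1HolderSet.frontier_subset_closure_exterior (h : IsC1HolderSet α Ω) :
    frontier Ω ⊆ closure (closure Ω)ᶜ := by
  intro p hp
  obtain ⟨e, ρ, hρ, hρe, hev⟩ := h.exists_definingFunction hp
  obtain ⟨U, hΩU, hU, hpU⟩ := eventually_nhds_iff.1 hev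
  have hp0 : 0 ≤ ρ p := by
    by_contra hlt
    rw [not_le] at hlt
    have : {x | x ∈ Ω} ∈ 𝓝 p := by
      filter_upwards [hU.mem_nhds hpU, hρ.continuous.continuousAt.eventually (gt_mem_nhds hlt)]
        with x hxU hx using (hΩU x hxU).2 hx
    exact hp.2 (mem_interior_iff_mem_nhds.2 this)
  refine mem_closure_of_tendsto (tendsto_add_smul_nhdsGT p e) ?_
  filter_upwards [(tendsto_add_smul_nhdsGT p e).eventually (hU.mem_nhds hpU),
    self_mem_nhdsWithin] with s hs hs0
  have hs0 : 0 < s := hs0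
  refine (notMem_closure_iff_of_definingFunction hU hρ.continuous hρe hΩU hs).2 ?_
  rw [hρe]
  linarith

theorem closure_diff_subset_closure_diff_closure {Ωo Ωi : Set (Euc n)} (ho : IsOpen Ωo)
    (hi : IsOpen Ωi) (hiα : IsC1HolderSet α Ωi) (hsub : closure Ωi ⊆ Ωo) :
    closure Ωo \ Ωi ⊆ closure (Ωo \ closure Ωi) := by
  rintro x ⟨hxo, hxi⟩
  by_cases hx : x ∈ closure Ωi
  · have h1 : x ∈ frontier Ωi := by rw [hi.frontier_eq]; exact ⟨hx, hxi⟩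
    exact ho.inter_closure ⟨hsub hx, hiα.frontier_subset_closure_exterior h1⟩
  · have := isClosed_closure.isOpen_compl.inter_closure (t := Ωo) ⟨hx, hxo⟩
    rwa [inter_comm] at this

end Geometry

section Regularity

variable {n : ℕ} {α : ℝ≥0} {D : Set (Euc n)} {u w : Euc n → ℝ}

theorem IsC1Holder.tendsto_gradient (h : IsC1Holder α D w) {x : Euc n} (hx : x ∈ closure D) :
    Tendsto (∇ w) (𝓝[D] x) (𝓝 (closureGradient D w x)) :=
  tendsto_extendFrom (h.gradient_extends x hx)

theorem closureGradient_eq_zero (h : ∀ x ∈ D, ∇ w x = 0) {x : Euc n} (hx : x ∈ closure D) :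
    closureGradient D w x = 0 :=
  extendFrom_eq hx <| tendsto_const_nhds.congr' <| by
    filter_upwards [self_mem_nhdsWithin] with y hy using (h y hy).symm

theorem IsC1Holder.exists_bound (hα : 0 < α) (hD : IsOpen D) (hb : Bornology.IsBounded D)
    (h : IsC1Holder α D w) : ∃ C, ∀ x ∈ D, |w x| ≤ C ∧ ‖∇ w x‖ ≤ C := by
  have hK : IsCompact (closure D) := hb.isCompact_closure
  obtain ⟨C1, h1⟩ := hK.exists_bound_of_continuousOn h.continuousOn
  obtain ⟨L, hL⟩ := h.holder
  obtain ⟨C2, h2⟩ := hK.exists_bound_of_continuousOn (hL.continuousOn hα)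
  refine ⟨max C1 C2, fun x hx => ⟨(h1 x (subset_closure hx)).trans (le_max_left _ _), ?_⟩⟩
  have hc : ContinuousAt (∇ w) x := (toDual ℝ (Euc n)).symm.continuous.continuousAt.comp
    ((h.contDiffOn.continuousOn_fderiv_of_isOpen hD le_rfl).continuousAt (hD.mem_nhds hx))
  have h3 : closureGradient D w x = ∇ w x :=
    extendFrom_eq (subset_closure hx) hc.continuousWithinAt
  rw [← h3]
  exact (h2 x (subset_closure hx)).trans (le_max_right _ _)

theorem IsC1Holder.tendsto_flux (h : IsC1Holder α D w) (huw : ∀ x ∈ D, u =ᶠ[𝓝 x] w)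
    {ρ : Euc n → ℝ} (hρ : ContDiff ℝ 1 ρ) {q : Euc n} (hq : q ∈ closure D) :
    Tendsto (fun x => u x * fderiv ℝ ρ x (∇ u x)) (𝓝[D] q)
      (𝓝 (w q * fderiv ℝ ρ q (closureGradient D w q))) := by
  have h1 : Tendsto w (𝓝[D] q) (𝓝 (w q)) := (h.continuousOn q hq).mono subset_closure
  have h2 : Tendsto (fderiv ℝ ρ) (𝓝[D] q) (𝓝 (fderiv ℝ ρ q)) :=
    (hρ.continuous_fderiv one_ne_zero).continuousAt.continuousWithinAt
  have h3 : Tendsto (fun x => fderiv ℝ ρ x (∇ w x)) (𝓝[D] q)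
      (𝓝 (fderiv ℝ ρ q (closureGradient D w q))) :=
    (isBoundedBilinearMap_apply.continuous.tendsto _).comp
      (h2.prodMk_nhds (h.tendsto_gradient hq))
  refine (h1.mul h3).congr' ?_
  filter_upwards [self_mem_nhdsWithin] with x hx
  rw [(huw x hx).self_of_nhds, (huw x hx).gradient_eq]

theorem gradient_eq_zero_of_eq_zero (hD : IsOpen D) (h : ∀ x ∈ D, w x = 0) :
    ∀ x ∈ D, ∇ w x = 0 := fun x hx => by
  have : w =ᶠ[𝓝 x] fun _ => 0 := by
    filter_upwards [hD.mem_nhds hx] with y hy using h y hy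
  rw [this.gradient_eq, gradient_fun_const]

theorem isC1Holder_of_eq_zero (hD : IsOpen D) (h : ∀ x ∈ closure D, w x = 0) :
    IsC1Holder α D w := by
  have hg := gradient_eq_zero_of_eq_zero hD fun x hx => h x (subset_closure hx)
  refine ⟨?_, ?_, fun x hx => ⟨0, ?_⟩, 0, ?_⟩
  · exact contDiffOn_const.congr fun x hx => h x (subset_closure hx)
  · exact continuousOn_const.congr h
  · refine tendsto_const_nhds.congr' ?_
    filter_upwards [self_mem_nhdsWithin] with y hy using (hg y hy).symm
  · intro x hx y hy
    simp [closureGradient_eq_zero hg hx, closureGradient_eq_zero hg hy]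

theorem harmonicOnNhd_of_eq_zero (hD : IsOpen D) (h : ∀ x ∈ D, w x = 0) :
    HarmonicOnNhd w D := fun x hx =>
  (harmonicAt_congr_nhds (f₂ := fun _ => 0) (by
    filter_upwards [hD.mem_nhds hx] with y hy using h y hy)).2 (harmonicAt_const 0)

theorem fderiv_eq_zero_of_gradient_eq_zero {x : Euc n} (h : ∇ w x = 0) : fderiv ℝ w x = 0 := by
  rw [← toDual_gradient, h, map_zero]

end Regularity

/-! ### Uniqueness for the transmission problem -/

section Uniqueness

variable {n : ℕ} {α : ℝ≥0} {Ωo Ωi : Set (Euc n)} {A : Euc n → Matrix (Fin 2) (Fin 2) ℝ}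
  {uo ui : Euc n → ℝ}

theorem nhdsWithin_le_nhdsWithin_of_mem_nhds {U s t : Set (Euc n)} {q : Euc n} (hU : U ∈ 𝓝 q)
    (h : ∀ x ∈ U, x ∈ s → x ∈ t) : 𝓝[s] q ≤ 𝓝[t] q := by
  refine nhdsWithin_le_iff.2 ?_
  filter_upwards [nhdsWithin_le_nhds hU, self_mem_nhdsWithin] with x hxU hxs using h x hxU hxs

/-- The energy argument: the gradients of a solution vanish on both sides of the interface. -/
theorem SolvesTransmission.gradient_eq_zero (hα : 0 < α) (hΩo : IsAdmissibleDomain α Ωo)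
    (hΩi : IsAdmissibleDomain α Ωi) (hsub : closure Ωi ⊆ Ωo) (hA : MatrixCondition α Ωi A)
    (huo : IsC1Holder α (Ωo \ closure Ωi) uo) (hui : IsC1Holder α Ωi ui)
    (hs : SolvesTransmission Ωo Ωi A uo ui) :
    (∀ x ∈ Ωo \ closure Ωi, ∇ uo x = 0) ∧ ∀ x ∈ Ωi, ∇ ui x = 0 := by
  classical
  set D := Ωo \ closure Ωi with hD
  have hDo : IsOpen D := hΩo.isOpen.sdiff isClosed_closure
  have hcl := closure_diff_subset_closure_diff_closure hΩo.isOpen hΩi.isOpen hΩi.isC1Holder hsub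
  set S := frontier Ωo ∪ frontier Ωi with hS
  have hSc : IsClosed S := isClosed_frontier.union isClosed_frontier
  -- The two functions are glued and extended by zero to the exterior of `Ωo`.
  set u : Euc n → ℝ := fun x => if x ∈ D then uo x else if x ∈ Ωi then ui x else 0 with hu
  have hnD : ∀ x ∈ Ωi, x ∉ D := fun x hx h => h.2 (subset_closure hx)
  have huD : ∀ x ∈ D, u =ᶠ[𝓝 x] uo := fun x hx => by
    filter_upwards [hDo.mem_nhds hx] with y hy
    simp [hu, hy]
  have huI : ∀ x ∈ Ωi, u =ᶠ[𝓝 x] ui := fun x hx => by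
    filter_upwards [hΩi.isOpen.mem_nhds hx] with y hy
    simp [hu, hy, hnD y hy]
  have hu0 : ∀ x ∉ closure Ωo, u x = 0 := fun x hx => by
    have h1 : x ∉ Ωo := fun h => hx (subset_closure h)
    have h2 : x ∉ Ωi := fun h => h1 (hsub (subset_closure h))
    simp [hu, hD, h1, h2]
  have huE : ∀ x ∉ closure Ωo, u =ᶠ[𝓝 x] fun _ => 0 := fun x hx => by
    filter_upwards [isClosed_closure.isOpen_compl.mem_nhds hx] with y hy using hu0 y hy
  have hcases : ∀ x ∈ Sᶜ, x ∈ D ∨ x ∈ Ωi ∨ x ∉ closure Ωo := by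
    intro x hx
    rw [hS, hΩo.isOpen.frontier_eq, hΩi.isOpen.frontier_eq] at hx
    by_contra! hcon
    obtain ⟨h1, h2, h3⟩ := hcon
    refine hx ?_
    by_cases h4 : x ∈ Ωo
    · exact Or.inr ⟨by_contra fun h5 => h1 ⟨h4, h5⟩, h2⟩
    · exact Or.inl ⟨h3, h4⟩
  have huH : HarmonicOnNhd u Sᶜ := by
    intro x hx
    rcases hcases x hx with h | h | h
    · exact (harmonicAt_congr_nhds (huD x h)).2 (hs.harmonic_outer x h)
    · exact (harmonicAt_congr_nhds (huI x h)).2 (hs.harmonic_inner x h)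
    · exact (harmonicAt_congr_nhds (huE x h)).2 (harmonicAt_const 0)
  obtain ⟨Co, hCo⟩ := huo.exists_bound hα hDo (hΩo.isBounded.subset sdiff_subset)
  obtain ⟨Ci, hCi⟩ := hui.exists_bound hα hΩi.isOpen hΩi.isBounded
  have hC : ∀ x ∈ Sᶜ, |u x| ≤ max (max Co Ci) 0 ∧ ‖∇ u x‖ ≤ max (max Co Ci) 0 := by
    intro x hx
    rcases hcases x hx with h | h | h
    · rw [(huD x h).self_of_nhds, (huD x h).gradient_eq]
      have := hCo x h
      exact ⟨this.1.trans (by simp), this.2.trans (by simp)⟩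
    · rw [(huI x h).self_of_nhds, (huI x h).gradient_eq]
      have := hCi x h
      exact ⟨this.1.trans (by simp), this.2.trans (by simp)⟩
    · rw [hu0 x h, (huE x h).gradient_eq, gradient_fun_const]
      simp
  have hgrad : ∀ x ∈ Sᶜ, ∇ u x = 0 := by
    refine gradient_eq_zero_of_locally_nonpos (μ := volume) hSc huH hC
      hΩo.isBounded.isCompact_closure hu0 fun p => ?_
    by_cases hpS : p ∈ S
    swap
    · refine ⟨Sᶜ, hSc.isOpen_compl, hpS, fun φ hφ hc hsupp _ => ?_⟩
      rw [setIntegral_eq_integral_of_forall_compl_eq_zero fun x hx =>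
        greenDensity_eq_zero_of_notMem_tsupport fun h => hx (hsupp h)]
      exact (integral_greenDensity_eq_zero hφ hc (huH.mono hsupp)).le
    rcases hpS with hp | hp
    · obtain ⟨e, ρ, hρ, hρe, hev⟩ := hΩo.isC1Holder.exists_definingFunction hp
      obtain ⟨V, hΩV, hV, hpV⟩ := eventually_nhds_iff.1 hev
      set U := V ∩ (closure Ωi)ᶜ with hUdef
      have hU : IsOpen U := hV.inter isClosed_closure.isOpen_compl
      have hΩU : ∀ x ∈ U, x ∈ Ωo ↔ ρ x < 0 := fun x hx => hΩV x hx.1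
      have hfr : ∀ x ∈ U, x ∈ frontier Ωo ↔ ρ x = 0 := fun x hx =>
        mem_frontier_iff_of_definingFunction hΩo.isOpen hU hρ.continuous hρe hΩU hx
      have hpU : p ∈ U := ⟨hpV, fun h => by
        rw [hΩo.isOpen.frontier_eq] at hp
        exact hp.2 (hsub h)⟩
      refine ⟨U, hU, hpU, fun φ hφ hc hsupp hφ0 => setIntegral_greenDensity_nonpos_of_jump hSc huH
        hC hρ hρe (fun x hx => ?_) (fun q hq hq0 => ⟨0, 0, le_rfl, ?_, ?_⟩) hφ hc hsupp hφ0⟩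
      · rw [← hfr x hx]
        exact or_iff_left fun h => hx.2 (frontier_subset_closure h)
      · refine tendsto_const_nhds.congr' ?_
        filter_upwards [nhdsWithin_le_nhds (hU.mem_nhds hq), self_mem_nhdsWithin] with x hxU hx
        rw [hu0 x ((notMem_closure_iff_of_definingFunction hU hρ.continuous hρe hΩU hxU).2 hx),
          zero_mul]
      · have hqf : q ∈ frontier Ωo := (hfr q hq).2 hq0
        have hqD : q ∈ closure D := hcl ⟨frontier_subset_closure hqf,
          fun h => hq.2 (subset_closure h)⟩
        obtain ⟨c, -, hc'⟩ := exists_fderiv_eq_mul_inner_outerNormal hΩo.isOpen hΩo.isC1Holder hU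
          hρ hΩU hq hqf hq0
        have ht := huo.tendsto_flux huD hρ hqD
        rw [hc', hs.neumann q hqf, mul_zero, mul_zero] at ht
        exact ht.mono_left (nhdsWithin_le_nhdsWithin_of_mem_nhds (hU.mem_nhds hq)
          fun x hxU hx => ⟨(hΩU x hxU).2 hx, hxU.2⟩)
    · obtain ⟨e, ρ, hρ, hρe, hev⟩ := hΩi.isC1Holder.exists_definingFunction hp
      obtain ⟨V, hΩV, hV, hpV⟩ := eventually_nhds_iff.1 hev
      set U := V ∩ Ωo with hUdef
      have hU : IsOpen U := hV.inter hΩo.isOpen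
      have hΩU : ∀ x ∈ U, x ∈ Ωi ↔ ρ x < 0 := fun x hx => hΩV x hx.1
      have hfr : ∀ x ∈ U, x ∈ frontier Ωi ↔ ρ x = 0 := fun x hx =>
        mem_frontier_iff_of_definingFunction hΩi.isOpen hU hρ.continuous hρe hΩU hx
      have hpU : p ∈ U := ⟨hpV, hsub (frontier_subset_closure hp)⟩
      refine ⟨U, hU, hpU, fun φ hφ hc hsupp hφ0 => setIntegral_greenDensity_nonpos_of_jump hSc huH
        hC hρ hρe (fun x hx => ?_) (fun q hq hq0 => ?_) hφ hc hsupp hφ0⟩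
      · rw [← hfr x hx]
        refine or_iff_right fun h => ?_
        rw [hΩo.isOpen.frontier_eq] at h
        exact h.2 hx.2
      · have hqf : q ∈ frontier Ωi := (hfr q hq).2 hq0
        have hqi : q ∉ Ωi := by rw [hΩi.isOpen.frontier_eq] at hqf; exact hqf.2
        have hqD : q ∈ closure D := hcl ⟨subset_closure hq.2, hqi⟩
        obtain ⟨c, hc0, hc'⟩ := exists_fderiv_eq_mul_inner_outerNormal hΩi.isOpen hΩi.isC1Holder hU
          hρ hΩU hq hqf hq0
        have hto := huo.tendsto_flux huD hρ hqD
        have hti := hui.tendsto_flux huI hρ (frontier_subset_closure hqf)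
        refine ⟨_, _, ?_, hto.mono_left (nhdsWithin_le_nhdsWithin_of_mem_nhds (hU.mem_nhds hq)
          fun x hxU hx => ⟨hxU.2, (notMem_closure_iff_of_definingFunction hU hρ.continuous hρe hΩU
            hxU).2 hx⟩), hti.mono_left (nhdsWithin_le_nhdsWithin_of_mem_nhds (hU.mem_nhds hq)
            fun x hxU hx => (hΩU x hxU).2 hx)⟩
        -- The jump of the flux is the quadratic form of `Ã` at the boundary values.
        have h1 := hA.nonneg ![uo q, ui q] q hqf
        have h2 := hs.coupling_outer q hqf
        have h3 := hs.coupling_inner q hqf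
        simp only [tildeMatrix, Matrix.mulVec, dotProduct, Fin.sum_univ_two, Matrix.of_apply,
          Matrix.cons_val_zero, Matrix.cons_val_one] at h1
        rw [← hD] at h2
        rw [hc', hc']
        have h4 := mul_nonneg hc0 h1
        linear_combination h4 + c * ui q * h3 - c * uo q * h2
  constructor
  · intro x hx
    rw [← (huD x hx).gradient_eq]
    refine hgrad x fun h => ?_
    rw [hS, hΩo.isOpen.frontier_eq] at h
    rcases h with h | h
    · exact h.2 hx.1
    · exact hx.2 (frontier_subset_closure h)
  · intro x hx
    rw [← (huI x hx).gradient_eq]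
    refine hgrad x fun h => ?_
    rw [hS, hΩo.isOpen.frontier_eq, hΩi.isOpen.frontier_eq] at h
    rcases h with h | h
    · exact h.2 (hsub (subset_closure hx))
    · exact h.2 hx

/-- The gradients vanish, so the solution is a pair of constants, which the nondegeneracy of `A`
forces to be zero. -/
theorem SolvesTransmission.eq_zero (hα : 0 < α) (hΩo : IsAdmissibleDomain α Ωo)
    (hΩi : IsAdmissibleDomain α Ωi) (hsub : closure Ωi ⊆ Ωo) (hA : MatrixCondition α Ωi A)
    (huo : IsC1Holder α (Ωo \ closure Ωi) uo) (hui : IsC1Holder α Ωi ui)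
    (hs : SolvesTransmission Ωo Ωi A uo ui) :
    (∀ x ∈ closure Ωo \ Ωi, uo x = 0) ∧ ∀ x ∈ closure Ωi, ui x = 0 := by
  obtain ⟨hgo, hgi⟩ := hs.gradient_eq_zero hα hΩo hΩi hsub hA huo hui
  have hcl := closure_diff_subset_closure_diff_closure hΩo.isOpen hΩi.isOpen hΩi.isC1Holder hsub
  have hDo : IsOpen (Ωo \ closure Ωi) := hΩo.isOpen.sdiff isClosed_closure
  obtain ⟨co, hco⟩ := exists_forall_eq_of_locally_constant_diff hΩo.isOpen
    hΩo.isConnected.isPreconnected isClosed_closure hsub hΩi.isConnected_exterior.isPreconnected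
    (v := uo) fun x hx => by
      obtain ⟨r, hr, hball⟩ := Metric.isOpen_iff.1 hDo x hx
      filter_upwards [Metric.ball_mem_nhds x hr] with y hy
      exact Metric.isOpen_ball.is_const_of_fderiv_eq_zero (convex_ball x r).isPreconnected
        ((huo.contDiffOn.differentiableOn one_ne_zero).mono hball)
        (fun z hz => fderiv_eq_zero_of_gradient_eq_zero (hgo z (hball hz))) hy
        (Metric.mem_ball_self hr)
  obtain ⟨x₀, hx₀⟩ := hΩi.isConnected.nonempty
  have hci : ∀ x ∈ Ωi, ui x = ui x₀ := fun x hx =>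
    hΩi.isOpen.is_const_of_fderiv_eq_zero hΩi.isConnected.isPreconnected
      (hui.contDiffOn.differentiableOn one_ne_zero)
      (fun z hz => fderiv_eq_zero_of_gradient_eq_zero (hgi z hz)) hx hx₀
  set ci := ui x₀ with hci'
  have hco' : ∀ x ∈ closure (Ωo \ closure Ωi), uo x = co :=
    EqOn.of_subset_closure (g := fun _ => co) hco huo.continuousOn continuousOn_const
      subset_closure subset_rfl
  have hci'' : ∀ x ∈ closure Ωi, ui x = ci :=
    EqOn.of_subset_closure (g := fun _ => ci) hci hui.continuousOn continuousOn_const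
      subset_closure subset_rfl
  have hzero : (![co, ci] : Fin 2 → ℝ) = 0 := by
    refine hA.nondegenerate _ fun x hx => ?_
    have hxi : x ∈ closure Ωi := frontier_subset_closure hx
    have hxD : x ∈ closure (Ωo \ closure Ωi) :=
      hcl ⟨subset_closure (hsub hxi), by rw [hΩi.isOpen.frontier_eq] at hx; exact hx.2⟩
    have h1 := hs.coupling_outer x hx
    have h2 := hs.coupling_inner x hx
    rw [closureGradient_eq_zero hgo hxD, inner_zero_right, hco' x hxD, hci'' x hxi] at h1
    rw [closureGradient_eq_zero hgi hxi, inner_zero_right, hco' x hxD, hci'' x hxi] at h2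
    ext i
    fin_cases i
    · simp [Matrix.mulVec, dotProduct, Fin.sum_univ_two]
      linarith
    · simp [Matrix.mulVec, dotProduct, Fin.sum_univ_two]
      linarith
  have hco0 : co = 0 := congrFun hzero 0
  have hci0 : ci = 0 := congrFun hzero 1
  exact ⟨fun x hx => (hco' x (hcl hx)).trans hco0, fun x hx => (hci'' x hx).trans hci0⟩

/-- The converse: on the boundaries the gradients are limits of zero gradients. -/
theorem solvesTransmission_of_eq_zero (hΩo : IsAdmissibleDomain α Ωo)
    (hΩi : IsAdmissibleDomain α Ωi) (hsub : closure Ωi ⊆ Ωo)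
    (huo : ∀ x ∈ closure Ωo \ Ωi, uo x = 0) (hui : ∀ x ∈ closure Ωi, ui x = 0) :
    IsC1Holder α (Ωo \ closure Ωi) uo ∧ IsC1Holder α Ωi ui ∧ SolvesTransmission Ωo Ωi A uo ui := by
  have hcl := closure_diff_subset_closure_diff_closure hΩo.isOpen hΩi.isOpen hΩi.isC1Holder hsub
  have hDo : IsOpen (Ωo \ closure Ωi) := hΩo.isOpen.sdiff isClosed_closure
  have hDsub : closure (Ωo \ closure Ωi) ⊆ closure Ωo \ Ωi := fun x hx =>
    ⟨closure_mono sdiff_subset hx, fun h => by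
      obtain ⟨y, hy, hyD⟩ := mem_closure_iff.1 hx _ hΩi.isOpen h
      exact hyD.2 (subset_closure hy)⟩
  have huo' : ∀ x ∈ closure (Ωo \ closure Ωi), uo x = 0 := fun x hx => huo x (hDsub hx)
  have huoD : ∀ x ∈ Ωo \ closure Ωi, uo x = 0 := fun x hx => huo' x (subset_closure hx)
  have huiD : ∀ x ∈ Ωi, ui x = 0 := fun x hx => hui x (subset_closure hx)
  have hgo := gradient_eq_zero_of_eq_zero hDo huoD
  have hgi := gradient_eq_zero_of_eq_zero hΩi.isOpen huiD
  have hfi : ∀ x ∈ frontier Ωi, x ∈ closure Ωi ∧ x ∈ closure Ωo \ Ωi := fun x hx => by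
    have h1 := frontier_subset_closure hx
    rw [hΩi.isOpen.frontier_eq] at hx
    exact ⟨h1, subset_closure (hsub h1), hx.2⟩
  have hfo : ∀ x ∈ frontier Ωo, x ∈ closure Ωo \ Ωi := fun x hx => by
    have h1 := frontier_subset_closure hx
    rw [hΩo.isOpen.frontier_eq] at hx
    exact ⟨h1, fun h => hx.2 (hsub (subset_closure h))⟩
  refine ⟨isC1Holder_of_eq_zero hDo huo', isC1Holder_of_eq_zero hΩi.isOpen hui,
    harmonicOnNhd_of_eq_zero hDo huoD, harmonicOnNhd_of_eq_zero hΩi.isOpen huiD,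
    fun x hx => ?_, fun x hx => ?_, fun x hx => ?_⟩
  · rw [closureGradient_eq_zero hgo (hcl (hfo x hx)), inner_zero_right]
  · rw [closureGradient_eq_zero hgo (hcl (hfi x hx).2), huo x (hfi x hx).2, hui x (hfi x hx).1]
    simp
  · rw [closureGradient_eq_zero hgi (hfi x hx).1, huo x (hfi x hx).2, hui x (hfi x hx).1]
    simp

end Uniqueness

end Transmission

theorem lemma4p2 (n : ℕ) (hn : 2 ≤ n) (α : ℝ≥0) (hα0 : 0 < α) (hα1 : α < 1)
    (Ωo Ωi : Set (Transmission.Euc n))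
    (hΩo : Transmission.IsAdmissibleDomain α Ωo) (hΩi : Transmission.IsAdmissibleDomain α Ωi)
    (hsub : closure Ωi ⊆ Ωo)
    (A : Transmission.Euc n → Matrix (Fin 2) (Fin 2) ℝ)
    (hA : Transmission.MatrixCondition α Ωi A)
    (uo ui : Transmission.Euc n → ℝ) :
    (Transmission.IsC1Holder α (Ωo \ closure Ωi) uo ∧ Transmission.IsC1Holder α Ωi ui ∧
        Transmission.SolvesTransmission Ωo Ωi A uo ui) ↔
      ((∀ x ∈ closure Ωo \ Ωi, uo x = 0) ∧ (∀ x ∈ closure Ωi, ui x = 0)) :=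
  ⟨fun h => h.2.2.eq_zero hα0 hΩo hΩi hsub hA h.1 h.2.1,
    fun h => Transmission.solvesTransmission_of_eq_zero hΩo hΩi hsub h.1 h.2⟩
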